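/- For an integer $k\ge 3$ and $0<q<1$ let $S_k(q)=\sum_{m\ge1}\frac{1}{m^k}\frac{q^m}{1-q^m}$, and say that this series has merit $a$ if its ratio of successive terms tends to $e^{-\pi\sqrt a}$. For $s>0$ put $q_s=e^{-\pi\sqrt s}$. Let $\rho=\frac12(1+\sqrt{-15})$ and, for $n\ge 1$, $$b_n=2\Re(\rho^n),\quad f_n=2^{2n+1}+1,\quad g_n=(f_n-2^n)(f_n+2^n),$$ $$r_n=2^{4n+1}-\Re\left(\rho^{2n}+(-3\rho)^n\right),\quad \widetilde r_n=2^{2n+1}g_n-b_n\left(5^n+(-3)^n+b_nf_n\right).$$ For every $n\ge1$, with $k=2n+1$, the following hold. (i) $b_n$ is a nonzero integer, and $r_n$ and $\widetilde r_n$ are positive integers. (ii) (First family.) There is a rational number $e_n$ such that $$r_n\zeta(k)=e_n\sqrt{15}\,\pi^k+(-3)^nb_nS_k(q_{5/3}^2)+(f_n^2-b_n^2)\left(S_k(q_{15})+2^{-2n}S_k(q_{15}^4)\right)-2^{-2n}f_n(g_n-b_n^2)S_k(q_{15}^2).$$ All the Lambert series in it converge and have merits at least $\frac{20}{3}$, and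 $S_k(q_{5/3}^2)$ has merit exactly $\frac{20}{3}$. (iii) (Second family.) There is a rational number $a_n$ such that $$\tfrac12\widetilde r_n\zeta(k)=a_n\sqrt{15}\,\pi^k+b_n\left(5^nS_k(q_{3/5}^4)+(-3)^nS_k(q_{5/3}^4)\right)+\sum_{d\in\{1,2,4\}}c_{n,d}S_k(q_{15}^d),$$ where $c_{n,1}=2^{2n}c_{n,4}=f_n(g_n-b_n^2)$ and $2^{2n}c_{n,2}=(b_nf_n-g_n)(b_nf_n+g_n)$. All the Lambert series in it converge and have merits at least $\frac{48}{5}$, and $S_k(q_{3/5}^4)$ has merit exactly $\frac{48}{5}$. Moreover $(r_1,\dots,r_7)=(37,\,535,\,8047,\,130495,\,2103727,\,33561055,\,536581327)$ and $(\widetilde r_1,\dots,\widetilde r_5)=(605,\,32957,\,2107325,\,134451197,\,8588427965)$. The first family begins with $$\zeta(3)=\tfrac{10\sqrt{15}}{999}\pi^3-\tfrac{3}{37}S_3(q_{5/3}^2)+\tfrac{80}{37}S_3(q_{15})-\tfrac{171}{37}S_3(q_{15}^2)+\tfrac{20}{37}S_3(q_{15}^4),$$ $$\zeta(5)=\tfrac{1327\sqrt{15}}{1516725}\pi^5-\tfrac{63}{535}S_5(q_{5/3}^2)+\tfrac{208}{107}S_5(q_{15})-\tfrac{2112}{535}S_5(q_{15}^2)+\tfrac{13}{107}S_5(q_{15}^4),$$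 and the second with $$\zeta(3)=\tfrac{16351}{330^2\sqrt{15}}\pi^3+\tfrac{2}{121}S_3(q_{3/5}^4)-\tfrac{6}{605}S_3(q_{5/3}^4)+\tfrac{342}{605}\left(4S_3(q_{15})+S_3(q_{15}^4)\right)-\tfrac{2924}{605}S_3(q_{15}^2).$$ -/

import Mathlib

noncomputable section

namespace LambertZeta

/-- The `m`-th term of `S_k(q) = ∑_{m ≥ 1} m^{-k} q^m / (1 - q^m)`, counting from `m = 0`. -/
def lambertTerm (k : ℕ) (q : ℝ) (m : ℕ) : ℝ :=
  1 / ((m : ℝ) + 1) ^ k * (q ^ (m + 1) / (1 - q ^ (m + 1)))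

/-- The Lambert series `S_k(q)`. -/
def S (k : ℕ) (q : ℝ) : ℝ := ∑' m : ℕ, lambertTerm k q m

/-- `S_k(q)` has merit `a`: its ratio of successive terms tends to `exp (-π √a)`. -/
def HasMerit (k : ℕ) (q a : ℝ) : Prop :=
  Filter.Tendsto (fun m : ℕ => lambertTerm k q (m + 1) / lambertTerm k q m) Filter.atTop
    (nhds (Real.exp (-Real.pi * Real.sqrt a)))

/-- `q_s = exp (-π √s)`. -/
def q (s : ℝ) : ℝ := Real.exp (-Real.pi * Real.sqrt s)

/-- `ρ = (1 + √(-15)) / 2`. -/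
def rho : ℂ := (1 + Complex.I * (Real.sqrt 15 : ℝ)) / 2

/-- `b_n = 2 Re (ρ^n)`. -/
def b (n : ℕ) : ℝ := 2 * (rho ^ n).re

/-- `f_n = 2^{2n+1} + 1`. -/
def f (n : ℕ) : ℝ := 2 ^ (2 * n + 1) + 1

/-- `g_n = (f_n - 2^n) (f_n + 2^n)`. -/
def g (n : ℕ) : ℝ := (f n - 2 ^ n) * (f n + 2 ^ n)

/-- `r_n`, the denominators of the first family. -/
def r (n : ℕ) : ℝ := 2 ^ (4 * n + 1) - (rho ^ (2 * n) + (-3 * rho) ^ n).re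

/-- `r̃_n`, the denominators of the second family. -/
def rTilde (n : ℕ) : ℝ := 2 ^ (2 * n + 1) * g n - b n * (5 ^ n + (-3) ^ n + b n * f n)

end LambertZeta

end

noncomputable section

namespace LambertZeta

/-! ### The cotangent series and its reciprocity law -/

/-! Write `F = eichler k` with `k = 2n+1`. In the nome `x = exp (2πiτ)` it is a Lambert series, and
on the imaginary axis `F(it) = S_k(exp (-2πt)) + ζ(k)/2`. So any linear relation among values of `F`
at purely imaginary points becomes a formula for `ζ(k)` once the coefficients are summed.

Relations come from four properties of `F`: period 1; `F(-conj τ) = conj F(τ)`; the reciprocity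
`F(τ) = τ^(2n) F(-1/τ)` up to `π^k` times a rational function over `ℚ` (`eichler_reciprocity`); and
the Hecke relation at 2, with eigenvalue `2 + 4^(-n) = f_n / 4^n` (`eichler_hecke`).

They are applied at CM points of `ℚ(√-15)`. The Hecke relation at `ρ/2` involves only points
equivalent to `ρ/2`, `ρ` and `i√15/3`. Its real part, combined with the Hecke relation at `ρ`,
removes `F(ρ/2)` (`eichler_first`). For the second family the Hecke relation at `i√15/3` brings in
`2i√15/5` and `2i√15/3`, and `eichler_first` removes `F(i√15/3)` (`eichler_second`). In both, the
Hecke relation at `i√15` (`eichler_rho`) trades `F(ρ)` for values at `i√15/2`, `i√15`, `2i√15`. The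
automorphy factors are powers of `ρ` and of rationals, and adding conjugates turns them into `b_n`.

The power of `π` has coefficient the imaginary part of an element of `ℚ(√-15)`, hence a rational
multiple of `√15`. Positivity of the denominators follows from `|b_n| ≤ 2·2^n`, and the merits from
`q_s^d = q_{s d²}`. -/

/-- The series `∑_{m ≥ 1} cot (π m τ) / m ^ k`. -/
def cotSum (k : ℕ) (τ : ℂ) : ℂ :=
  ∑' m : ℕ, Complex.cot (Real.pi * (((m : ℂ) + 1) * τ)) / ((m : ℂ) + 1) ^ k

/-- The rational number `ζ(2j) / π ^ (2j)`. -/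
def zetaEvenCoeff (j : ℕ) : ℚ :=
  (-1) ^ (j + 1) * 2 ^ (2 * j - 1) * bernoulli (2 * j) / (2 * j).factorial

/-- The double series `∑_{m, l ≥ 1} m ^ (-2n) (m² τ² - l²)⁻¹`. -/
def doubleSum (n : ℕ) (τ : ℂ) : ℂ :=
  ∑' p : ℕ × ℕ, 1 / (((p.1 : ℂ) + 1) ^ (2 * n) * (((p.1 : ℂ) + 1) ^ 2 * τ ^ 2 - ((p.2 : ℂ) + 1) ^ 2))

/-- The rational function that measures the failure of `eichler` to be modular, up to a power
of `π`. -/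
def period (n : ℕ) (τ : ℂ) : ℂ :=
  zetaEvenCoeff (n + 1) * (1 / τ + τ ^ (2 * n + 1))
    - 2 * ∑ j ∈ Finset.range n, τ ^ (2 * j + 1) * (zetaEvenCoeff (n - j) * zetaEvenCoeff (j + 1))

/-- The Eichler integral `S_k + ζ(k) / 2` of an Eisenstein series, as a cotangent series. -/
def eichler (k : ℕ) (τ : ℂ) : ℂ := Complex.I / 2 * cotSum k τ

theorem hasSum_zetaEven {j : ℕ} (hj : j ≠ 0) :
    HasSum (fun m : ℕ => 1 / ((m : ℂ) + 1) ^ (2 * j)) (zetaEvenCoeff j * (Real.pi : ℂ) ^ (2 * j)) := by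
  have hv : (zetaEvenCoeff j : ℝ) * Real.pi ^ (2 * j)
      + ∑ i ∈ Finset.range 1, 1 / ((i : ℕ) : ℝ) ^ (2 * j) =
      (-1) ^ (j + 1) * 2 ^ (2 * j - 1) * Real.pi ^ (2 * j) * (bernoulli (2 * j) : ℝ)
        / (2 * j).factorial := by
    -- The index-0 term split off by the shift is `1 / 0 = 0`, so nothing is lost.
    rw [Finset.sum_range_one, Nat.cast_zero, zero_pow (by omega), zetaEvenCoeff]
    push_cast
    ring
  have h : HasSum (fun m : ℕ => 1 / ((m + 1 : ℕ) : ℝ) ^ (2 * j))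
      ((zetaEvenCoeff j : ℝ) * Real.pi ^ (2 * j)) := by
    refine (hasSum_nat_add_iff (f := fun m : ℕ => 1 / (m : ℝ) ^ (2 * j)) 1).2 ?_
    rw [hv]
    exact hasSum_zeta_nat hj
  have h' := Complex.hasSum_ofReal.2 h
  convert h' using 1
  · ext m; push_cast; rfl
  · push_cast; rfl

/-- Multiplying by `conj τ` makes the `y` term real, so it drops out of the imaginary part. -/
theorem im_mul_le_norm_sub_mul (τ : ℂ) (x y : ℝ) : |x| * |τ.im| ≤ ‖(y : ℂ) * τ - x‖ * ‖τ‖ := by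
  have h : (((y : ℂ) * τ - x) * (starRingEnd ℂ) τ).im = x * τ.im := by
    simp [Complex.mul_im]; ring
  calc |x| * |τ.im| = |(((y : ℂ) * τ - x) * (starRingEnd ℂ) τ).im| := by rw [h, abs_mul]
    _ ≤ ‖((y : ℂ) * τ - x) * (starRingEnd ℂ) τ‖ := Complex.abs_im_le_norm _
    _ = _ := by rw [norm_mul, Complex.norm_conj]

/-- The bound is uniform in `y`; this is what dominates the double series by a product of two
convergent series. -/
theorem le_norm_sq_mul_sq_sub_sq {τ : ℂ} (hτ : 0 < τ.im) (x y : ℝ) :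
    (τ.im / ‖τ‖) ^ 2 * x ^ 2 ≤ ‖(y : ℂ) ^ 2 * τ ^ 2 - (x : ℂ) ^ 2‖ := by
  have hn : 0 < ‖τ‖ := norm_pos_iff.2 fun h => by simp [h] at hτ
  have h1 := im_mul_le_norm_sub_mul τ x y
  have h2 := im_mul_le_norm_sub_mul τ (-x) y
  rw [abs_neg] at h2
  have e : (y : ℂ) ^ 2 * τ ^ 2 - (x : ℂ) ^ 2 = ((y : ℂ) * τ - x) * ((y : ℂ) * τ - (-x : ℝ)) := by
    push_cast; ring
  rw [e, norm_mul, div_pow, div_mul_eq_mul_div, div_le_iff₀ (by positivity)]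
  have h3 := mul_le_mul h1 h2 (by positivity) (by positivity)
  rw [abs_of_pos hτ] at h3
  nlinarith [sq_abs x]

theorem summable_doubleSum {n : ℕ} (hn : 1 ≤ n) {τ : ℂ} (hτ : 0 < τ.im) :
    Summable fun p : ℕ × ℕ =>
      1 / (((p.1 : ℂ) + 1) ^ (2 * n) * (((p.1 : ℂ) + 1) ^ 2 * τ ^ 2 - ((p.2 : ℂ) + 1) ^ 2)) := by
  have hn0 : 0 < ‖τ‖ := norm_pos_iff.2 fun h => by simp [h] at hτ
  have h1 : ∀ j : ℕ, 1 ≤ j → Summable fun m : ℕ => 1 / ((m : ℝ) + 1) ^ (2 * j) := fun j hj => by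
    have := (summable_nat_add_iff 1).2 (Real.summable_one_div_nat_pow (p := 2 * j).2 (by omega))
    simpa using this
  have h2 := ((h1 n hn).mul_of_nonneg (h1 1 le_rfl) (fun _ => by positivity)
    (fun _ => by positivity)).mul_left ((τ.im / ‖τ‖) ^ 2)⁻¹
  refine Summable.of_norm_bounded h2 fun p => ?_
  have h3 := le_norm_sq_mul_sq_sub_sq hτ ((p.2 : ℝ) + 1) ((p.1 : ℝ) + 1)
  push_cast at h3
  have e : ‖((p.1 : ℂ) + 1)‖ = (p.1 : ℝ) + 1 := by
    rw [← Nat.cast_add_one, Complex.norm_natCast]; push_cast; rfl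
  rw [norm_div, norm_one, norm_mul, norm_pow, e, mul_one, ← one_div, one_div_mul_one_div,
    one_div_mul_one_div]
  apply one_div_le_one_div_of_le
  · positivity
  · calc _ = ((p.1 : ℝ) + 1) ^ (2 * n) * ((τ.im / ‖τ‖) ^ 2 * ((p.2 : ℝ) + 1) ^ 2) := by ring
      _ ≤ _ := by gcongr

theorem ne_zero_of_im_pos {τ : ℂ} (hτ : 0 < τ.im) : τ ≠ 0 := fun h => by simp [h] at hτ

theorem sq_mul_sq_sub_sq_ne_zero {τ : ℂ} (hτ : 0 < τ.im) (m l : ℕ) :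
    ((m : ℂ) + 1) ^ 2 * τ ^ 2 - ((l : ℂ) + 1) ^ 2 ≠ 0 := by
  have hn0 : 0 < ‖τ‖ := norm_pos_iff.2 (ne_zero_of_im_pos hτ)
  have h := le_norm_sq_mul_sq_sub_sq hτ ((l : ℝ) + 1) ((m : ℝ) + 1)
  push_cast at h
  exact norm_pos_iff.1 (lt_of_lt_of_le (by positivity) h)

theorem cot_pi_mul_eq {τ : ℂ} (hτ : 0 < τ.im) (m : ℕ) :
    Complex.cot (Real.pi * (((m : ℂ) + 1) * τ)) = (Real.pi : ℂ)⁻¹ * (1 / (((m : ℂ) + 1) * τ)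
      + 2 * τ * ∑' l : ℕ, ((m : ℂ) + 1) / (((m : ℂ) + 1) ^ 2 * τ ^ 2 - ((l : ℂ) + 1) ^ 2)) := by
  have him : 0 < (((m : ℂ) + 1) * τ).im := by
    have : ((m : ℂ) + 1) = ((m + 1 : ℝ) : ℂ) := by push_cast; rfl
    rw [this, Complex.im_ofReal_mul]; positivity
  have hi : ((m : ℂ) + 1) * τ ∈ Complex.integerComplement :=
    UpperHalfPlane.coe_mem_integerComplement ⟨_, him⟩
  have h := cot_series_rep' hi
  have hpi : (Real.pi : ℂ) ≠ 0 := by exact_mod_cast Real.pi_ne_zero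
  have e : ∀ l : ℕ, 1 / (((m : ℂ) + 1) * τ - (l + 1)) + 1 / (((m : ℂ) + 1) * τ + (l + 1)) =
      2 * τ * (((m : ℂ) + 1) / (((m : ℂ) + 1) ^ 2 * τ ^ 2 - ((l : ℂ) + 1) ^ 2)) := fun l => by
    have h0 := sq_mul_sq_sub_sq_ne_zero hτ m l
    have h1 : ((m : ℂ) + 1) * τ - (l + 1) ≠ 0 := fun h => h0 (by
      linear_combination (((m : ℂ) + 1) * τ + ((l : ℂ) + 1)) * h)
    have h2 : ((m : ℂ) + 1) * τ + (l + 1) ≠ 0 := fun h => h0 (by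
      linear_combination (((m : ℂ) + 1) * τ - ((l : ℂ) + 1)) * h)
    rw [div_add_div _ _ h1 h2, mul_div_assoc', div_eq_div_iff (mul_ne_zero h1 h2) h0]
    ring
  simp_rw [e, tsum_mul_left] at h
  rw [eq_inv_mul_iff_mul_eq₀ hpi]
  linear_combination h

/-- Partial fractions of the cotangent: the poles at 0 give the `ζ(2n+2)` term, the remaining poles
pair up into `doubleSum`. -/
theorem cotSum_eq {n : ℕ} (hn : 1 ≤ n) {τ : ℂ} (hτ : 0 < τ.im) :
    cotSum (2 * n + 1) τ = (Real.pi : ℂ)⁻¹ *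
      (zetaEvenCoeff (n + 1) * (Real.pi : ℂ) ^ (2 * (n + 1)) / τ + 2 * τ * doubleSum n τ) := by
  have hτ0 := ne_zero_of_im_pos hτ
  have hs := summable_doubleSum hn hτ
  have h1 := (hs.hasSum.prod_fiberwise fun m => (hs.prod_factor m).hasSum)
  have h2 := (((hasSum_zetaEven (Nat.succ_ne_zero n)).div_const τ).add
    (h1.mul_left (2 * τ))).mul_left (Real.pi : ℂ)⁻¹
  rw [cotSum, doubleSum, ← h2.tsum_eq]
  refine tsum_congr fun m => ?_
  have hm : (m : ℂ) + 1 ≠ 0 := Nat.cast_add_one_ne_zero m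
  have e : ∀ l : ℕ, 1 / (((m : ℂ) + 1) ^ (2 * n) * (((m : ℂ) + 1) ^ 2 * τ ^ 2 - ((l : ℂ) + 1) ^ 2))
      = 1 / ((m : ℂ) + 1) ^ (2 * n + 1) *
        (((m : ℂ) + 1) / (((m : ℂ) + 1) ^ 2 * τ ^ 2 - ((l : ℂ) + 1) ^ 2)) := fun l => by
    have := sq_mul_sq_sub_sq_ne_zero hτ m l
    field_simp
    ring
  simp_rw [e, tsum_mul_left, cot_pi_mul_eq hτ m, Nat.succ_eq_add_one]
  field_simp
  ring

/-- For `X = m²`, `Y = l²`: dividing `(X τ²)^n - Y^n` by `X τ² - Y` leaves a finite geometric sum,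
whose terms separate `m` from `l`. The remainder is the original term with `m`, `l` exchanged and
`τ` replaced by `-1/τ`. -/
theorem doubleSum_term_reciprocity (n : ℕ) {τ X Y : ℂ} (hτ : τ ≠ 0) (hX : X ≠ 0) (hY : Y ≠ 0)
    (hD : X * τ ^ 2 - Y ≠ 0) :
    1 / (X ^ n * (X * τ ^ 2 - Y)) =
      -(∑ j ∈ Finset.range n, τ ^ (2 * j) * (1 / X ^ (n - j) * (1 / Y ^ (j + 1))))
        - τ ^ (2 * n) / τ ^ 2 * (1 / (Y ^ n * (Y * (-1 / τ) ^ 2 - X))) := by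
  have h := (Commute.all (X * τ ^ 2) Y).geom_sum₂_mul n
  have hs : ∑ j ∈ Finset.range n, τ ^ (2 * j) * (1 / X ^ (n - j) * (1 / Y ^ (j + 1))) =
      1 / (X ^ n * Y ^ n) * ∑ j ∈ Finset.range n, (X * τ ^ 2) ^ j * Y ^ (n - 1 - j) := by
    rw [Finset.mul_sum]
    refine Finset.sum_congr rfl fun j hj => ?_
    have hj' := Finset.mem_range.1 hj
    obtain ⟨i, rfl⟩ : ∃ i, n = j + 1 + i := ⟨n - (j + 1), by omega⟩
    rw [show j + 1 + i - j = i + 1 by omega, show j + 1 + i - 1 - j = i by omega]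
    field_simp
    ring
  have hD' : Y * (-1 / τ) ^ 2 - X = -(X * τ ^ 2 - Y) / τ ^ 2 := by field_simp; ring
  rw [hs, eq_div_of_mul_eq hD h, hD']
  have : τ ^ (2 * n) = (τ ^ 2) ^ n := pow_mul _ _ _
  rw [this]
  field_simp
  ring

theorem neg_one_div_im_pos {τ : ℂ} (hτ : 0 < τ.im) : 0 < (-1 / τ).im := by
  have := (UpperHalfPlane.im_inv_neg_coe_pos ⟨τ, hτ⟩)
  rw [neg_div, one_div, ← inv_neg]
  exact this

theorem hasSum_mul_prod {u v : ℕ → ℂ} {a b : ℂ} (hu : HasSum u a) (hv : HasSum v b) :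
    HasSum (fun p : ℕ × ℕ => u p.1 * v p.2) (a * b) :=
  hu.mul hv (summable_mul_of_summable_norm hu.summable.norm hv.summable.norm)

theorem hasSum_zetaEven_mul {i j : ℕ} (hi : i ≠ 0) (hj : j ≠ 0) :
    HasSum (fun p : ℕ × ℕ => 1 / ((p.1 : ℂ) + 1) ^ (2 * i) * (1 / ((p.2 : ℂ) + 1) ^ (2 * j)))
      (zetaEvenCoeff i * zetaEvenCoeff j * (Real.pi : ℂ) ^ (2 * i + 2 * j)) := by
  have h := hasSum_mul_prod (hasSum_zetaEven hi) (hasSum_zetaEven hj)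
  have e : (zetaEvenCoeff i : ℂ) * (Real.pi : ℂ) ^ (2 * i) *
        (zetaEvenCoeff j * (Real.pi : ℂ) ^ (2 * j)) =
      zetaEvenCoeff i * zetaEvenCoeff j * (Real.pi : ℂ) ^ (2 * i + 2 * j) := by
    rw [pow_add]; ring
  rwa [e] at h

theorem doubleSum_reciprocity {n : ℕ} (hn : 1 ≤ n) {τ : ℂ} (hτ : 0 < τ.im) :
    doubleSum n τ = -(∑ j ∈ Finset.range n, τ ^ (2 * j) *
        (zetaEvenCoeff (n - j) * zetaEvenCoeff (j + 1) * (Real.pi : ℂ) ^ (2 * n + 2)))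
      - τ ^ (2 * n) / τ ^ 2 * doubleSum n (-1 / τ) := by
  have hτ0 := ne_zero_of_im_pos hτ
  -- Absolute convergence allows the exchange of the two summation indices.
  have h1 : HasSum (fun p : ℕ × ℕ => 1 / (((p.2 : ℂ) + 1) ^ (2 * n) *
      (((p.2 : ℂ) + 1) ^ 2 * (-1 / τ) ^ 2 - ((p.1 : ℂ) + 1) ^ 2))) (doubleSum n (-1 / τ)) :=
    (Equiv.prodComm ℕ ℕ).hasSum_iff.2 (summable_doubleSum hn (neg_one_div_im_pos hτ)).hasSum
  have h2 : ∀ j ∈ Finset.range n, HasSum (fun p : ℕ × ℕ => τ ^ (2 * j) *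
      (1 / ((p.1 : ℂ) + 1) ^ (2 * (n - j)) * (1 / ((p.2 : ℂ) + 1) ^ (2 * (j + 1)))))
      (τ ^ (2 * j) *
        (zetaEvenCoeff (n - j) * zetaEvenCoeff (j + 1) * (Real.pi : ℂ) ^ (2 * n + 2))) := by
    intro j hj
    have hj' := Finset.mem_range.1 hj
    rw [show 2 * n + 2 = 2 * (n - j) + 2 * (j + 1) by omega]
    exact (hasSum_zetaEven_mul (by omega) (by omega)).mul_left _
  have h3 := ((hasSum_sum h2).neg.sub (h1.mul_left (τ ^ (2 * n) / τ ^ 2))).tsum_eq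
  refine Eq.trans (tsum_congr fun p => ?_) h3
  have hm : (p.1 : ℂ) + 1 ≠ 0 := Nat.cast_add_one_ne_zero p.1
  have hl : (p.2 : ℂ) + 1 ≠ 0 := Nat.cast_add_one_ne_zero p.2
  have h := doubleSum_term_reciprocity n hτ0 (pow_ne_zero 2 hm) (pow_ne_zero 2 hl)
    (sq_mul_sq_sub_sq_ne_zero hτ p.1 p.2)
  simpa only [← pow_mul] using h

/-- The terms `1/τ` and `τ^(2n+1)` of `period` come from the poles at 0 in the cotangent series at
`τ` and at `-1/τ`; its finite sum comes from `doubleSum_reciprocity`. -/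
theorem eichler_reciprocity {n : ℕ} (hn : 1 ≤ n) {τ : ℂ} (hτ : 0 < τ.im) :
    eichler (2 * n + 1) τ = τ ^ (2 * n) * eichler (2 * n + 1) (-1 / τ)
      + Complex.I / 2 * (Real.pi : ℂ) ^ (2 * n + 1) * period n τ := by
  have hτ0 := ne_zero_of_im_pos hτ
  have hpi : (Real.pi : ℂ) ≠ 0 := by exact_mod_cast Real.pi_ne_zero
  have hs : ∑ j ∈ Finset.range n, τ ^ (2 * j + 1) *
        ((zetaEvenCoeff (n - j) : ℂ) * zetaEvenCoeff (j + 1)) * (Real.pi : ℂ) ^ (2 * n + 2) =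
      τ * ∑ j ∈ Finset.range n, τ ^ (2 * j) *
        (zetaEvenCoeff (n - j) * zetaEvenCoeff (j + 1) * (Real.pi : ℂ) ^ (2 * n + 2)) := by
    rw [Finset.mul_sum]
    exact Finset.sum_congr rfl fun j _ => by ring
  rw [← Finset.sum_mul] at hs
  rw [eichler, eichler, cotSum_eq hn hτ, cotSum_eq hn (neg_one_div_im_pos hτ),
    doubleSum_reciprocity hn hτ, period]
  generalize doubleSum n (-1 / τ) = D
  generalize (zetaEvenCoeff (n + 1) : ℂ) = z
  rw [mul_add, mul_comm (2 * τ), sub_mul, neg_mul, ← mul_assoc _ 2 τ, mul_right_comm _ 2 τ,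
    mul_comm _ τ, ← hs]
  generalize ∑ j ∈ Finset.range n, τ ^ (2 * j + 1) *
        ((zetaEvenCoeff (n - j) : ℂ) * zetaEvenCoeff (j + 1)) = s
  field_simp
  ring

/-! ### The Eichler integral as a function of the nome -/

/-- The `m`-th term of `S_k(x) + ζ(k) / 2`, counting from `m = 0`. -/
def nomeTerm (k : ℕ) (x : ℂ) (m : ℕ) : ℂ :=
  (1 + x ^ (m + 1)) / (1 - x ^ (m + 1)) / (2 * ((m : ℂ) + 1) ^ k)

theorem one_sub_pow_ne_zero {x : ℂ} (hx : ‖x‖ < 1) (m : ℕ) : 1 - x ^ (m + 1) ≠ 0 := fun h => by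
  have h1 : ‖x ^ (m + 1)‖ < 1 := by
    rw [norm_pow]; exact pow_lt_one₀ (norm_nonneg _) hx (Nat.succ_ne_zero m)
  rw [← sub_eq_zero.1 h, norm_one] at h1
  exact lt_irrefl _ h1

theorem summable_inv_add_one_pow {k : ℕ} (hk : 1 < k) :
    Summable fun m : ℕ => 1 / ((m : ℝ) + 1) ^ k := by
  have := (summable_nat_add_iff 1).2 (Real.summable_one_div_nat_pow (p := k).2 hk)
  simpa using this

theorem summable_nomeTerm {k : ℕ} (hk : 1 < k) {x : ℂ} (hx : ‖x‖ < 1) :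
    Summable (nomeTerm k x) := by
  refine Summable.of_norm_bounded ((summable_inv_add_one_pow hk).mul_left (1 / (1 - ‖x‖)))
    fun m => ?_
  have hp : ‖x ^ (m + 1)‖ ≤ ‖x‖ := by
    rw [norm_pow]; exact pow_le_of_le_one (norm_nonneg _) hx.le (Nat.succ_ne_zero m)
  have h1 : ‖1 + x ^ (m + 1)‖ ≤ 2 := by
    calc _ ≤ ‖(1 : ℂ)‖ + ‖x ^ (m + 1)‖ := norm_add_le _ _
      _ ≤ 2 := by rw [norm_one]; linarith
  have h2 : 1 - ‖x‖ ≤ ‖1 - x ^ (m + 1)‖ := by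
    have := norm_sub_norm_le (1 : ℂ) (x ^ (m + 1))
    rw [norm_one] at this; linarith
  have e : ‖((m : ℂ) + 1)‖ = (m : ℝ) + 1 := by
    rw [← Nat.cast_add_one, Complex.norm_natCast]; push_cast; rfl
  have hpos : 0 < 1 - ‖x‖ := by linarith
  rw [nomeTerm, norm_div, norm_div, norm_mul, norm_pow, e, Complex.norm_ofNat]
  calc ‖1 + x ^ (m + 1)‖ / ‖1 - x ^ (m + 1)‖ / (2 * ((m : ℝ) + 1) ^ k)
      ≤ 2 / (1 - ‖x‖) / (2 * ((m : ℝ) + 1) ^ k) := by gcongr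
    _ = 1 / (1 - ‖x‖) * (1 / ((m : ℝ) + 1) ^ k) := by field_simp

theorem eichler_eq_tsum (k : ℕ) (τ : ℂ) :
    eichler k τ = ∑' m, nomeTerm k (Complex.exp (2 * Real.pi * Complex.I * τ)) m := by
  rw [eichler, cotSum, ← tsum_mul_left]
  refine tsum_congr fun m => ?_
  have e : 2 * Complex.I * (Real.pi * (((m : ℂ) + 1) * τ)) =
      ((m + 1 : ℕ) : ℂ) * (2 * Real.pi * Complex.I * τ) := by push_cast; ring
  rw [Complex.cot_eq_exp_ratio, e, Complex.exp_nat_mul, nomeTerm]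
  generalize Complex.exp (2 * Real.pi * Complex.I * τ) ^ (m + 1) = y
  have hI := Complex.I_ne_zero
  rw [div_mul_eq_div_div_swap, div_mul_eq_div_div_swap]
  field_simp
  ring

theorem norm_exp_lt_one {τ : ℂ} (hτ : 0 < τ.im) :
    ‖Complex.exp (2 * Real.pi * Complex.I * τ)‖ < 1 := by
  rw [Complex.norm_exp, Real.exp_lt_one_iff]
  simp
  positivity

theorem eichler_add_one (k : ℕ) (τ : ℂ) : eichler k (τ + 1) = eichler k τ := by
  rw [eichler_eq_tsum, eichler_eq_tsum, mul_add, mul_one, Complex.exp_add, Complex.exp_two_pi_mul_I,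
    mul_one]

theorem eichler_neg_conj (k : ℕ) (τ : ℂ) :
    eichler k (-(starRingEnd ℂ) τ) = (starRingEnd ℂ) (eichler k τ) := by
  rw [eichler_eq_tsum, eichler_eq_tsum, Complex.conj_tsum]
  refine tsum_congr fun m => ?_
  have : 2 * Real.pi * Complex.I * -(starRingEnd ℂ) τ =
      (starRingEnd ℂ) (2 * Real.pi * Complex.I * τ) := by simp [Complex.conj_ofNat]
  rw [this, Complex.exp_conj]
  simp [nomeTerm, Complex.conj_ofNat]

/-- With `y = x^M`, odd `M` gives `(1+y)/(1-y) + (1-y)/(1+y) = 2(1+y²)/(1-y²)`, which cancels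
against the series in `x²`. For `M = 2j` the terms at `x` and `-x` agree, and the leftover is
`2^(1-k)` times the difference of the `j`-th terms at `x²` and `x⁴`. -/
theorem tsum_nomeTerm_hecke {k : ℕ} (hk : 1 < k) {x : ℂ} (hx : ‖x‖ < 1) :
    ∑' m, nomeTerm k x m + ∑' m, nomeTerm k (-x) m + 2 / 2 ^ k * ∑' m, nomeTerm k (x ^ 4) m =
      (2 + 2 / 2 ^ k) * ∑' m, nomeTerm k (x ^ 2) m := by
  have hpow : ∀ j : ℕ, j ≠ 0 → ‖x ^ j‖ < 1 := fun j hj => by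
    rw [norm_pow]; exact pow_lt_one₀ (norm_nonneg _) hx hj
  have h1 := summable_nomeTerm hk hx
  have h2 := summable_nomeTerm hk (x := -x) (by rwa [norm_neg])
  have h3 := summable_nomeTerm hk (hpow 2 two_ne_zero)
  have h4 := summable_nomeTerm hk (hpow 4 four_ne_zero)
  have hL := (h1.hasSum.add h2.hasSum).sub (h3.hasSum.mul_left 2)
  have hR := (h3.hasSum.sub h4.hasSum).mul_left (2 / 2 ^ k)
  -- Indices are shifted by one, so odd indices `2i+1` stand for the even integers `2(i+1)`.
  have hinj : Function.Injective fun i : ℕ => 2 * i + 1 := fun i j h => by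
    simpa using h
  have hodd : ∀ m ∉ Set.range fun i : ℕ => 2 * i + 1,
      nomeTerm k x m + nomeTerm k (-x) m - 2 * nomeTerm k (x ^ 2) m = 0 := fun m hm => by
    obtain ⟨i, rfl⟩ : Even m := by
      by_contra h
      obtain ⟨i, rfl⟩ := Nat.not_even_iff_odd.1 h
      exact hm ⟨i, rfl⟩
    have e1 := one_sub_pow_ne_zero hx (i + i)
    have e2 := one_sub_pow_ne_zero (hpow 2 two_ne_zero) (i + i)
    have e3 : (((i + i : ℕ) : ℂ) + 1) ≠ 0 := Nat.cast_add_one_ne_zero _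
    have hsq : (x ^ 2) ^ (i + i + 1) = (x ^ (i + i + 1)) ^ 2 := by
      rw [← pow_mul, ← pow_mul, mul_comm]
    rw [hsq] at e2
    have ho : Odd (i + i + 1) := ⟨i, by ring⟩
    simp only [nomeTerm]
    rw [ho.neg_pow, hsq]
    generalize x ^ (i + i + 1) = y at *
    have e4 : 1 + y ≠ 0 := fun h => e2 (by linear_combination (1 - y) * h)
    rw [sub_neg_eq_add, ← sub_eq_add_neg]
    field_simp
    ring
  have heven : ∀ i : ℕ, nomeTerm k x (2 * i + 1) + nomeTerm k (-x) (2 * i + 1)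
      - 2 * nomeTerm k (x ^ 2) (2 * i + 1) =
        2 / 2 ^ k * (nomeTerm k (x ^ 2) i - nomeTerm k (x ^ 4) i) := fun i => by
    have e1 := one_sub_pow_ne_zero (hpow 2 two_ne_zero) i
    have e2 := one_sub_pow_ne_zero (hpow 4 four_ne_zero) i
    have e3 : (i : ℂ) + 1 ≠ 0 := Nat.cast_add_one_ne_zero _
    have he : Even (2 * i + 1 + 1) := ⟨i + 1, by ring⟩
    simp only [nomeTerm]
    rw [he.neg_pow, show 2 * i + 1 + 1 = 2 * (i + 1) by ring, pow_mul, ← pow_mul,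
      show (x ^ 4) ^ (i + 1) = (x ^ (2 * (2 * (i + 1)))) by rw [← pow_mul]; ring_nf,
      pow_mul x 2 (2 * (i + 1)), show ((2 * i + 1 : ℕ) : ℂ) + 1 = 2 * ((i : ℂ) + 1) by
        push_cast; ring, mul_pow]
    rw [show (x ^ 4) ^ (i + 1) = (x ^ 2) ^ (2 * (i + 1)) by rw [← pow_mul, ← pow_mul]; ring_nf]
      at e2
    generalize (x ^ 2) ^ (2 * (i + 1)) = z at *
    field_simp
    ring
  rw [← hinj.hasSum_iff hodd] at hL
  rw [← funext heven] at hR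
  have h := HasSum.unique hL hR
  linear_combination h

theorem eichler_hecke {n : ℕ} (hn : 1 ≤ n) {τ : ℂ} (hτ : 0 < τ.im) :
    eichler (2 * n + 1) (τ / 2) + eichler (2 * n + 1) ((τ + 1) / 2)
      + 1 / 4 ^ n * eichler (2 * n + 1) (2 * τ) = (2 + 1 / 4 ^ n) * eichler (2 * n + 1) τ := by
  have h := tsum_nomeTerm_hecke (k := 2 * n + 1) (by omega)
    (norm_exp_lt_one (τ := τ / 2) (by simpa using hτ))
  have hc : (2 : ℂ) / 2 ^ (2 * n + 1) = 1 / 4 ^ n := by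
    rw [pow_succ, pow_mul]; norm_num; field_simp
  simp only [eichler_eq_tsum]
  rw [hc, ← Complex.exp_nat_mul, ← Complex.exp_nat_mul] at h
  convert h using 5
  · rw [← mul_neg_one, ← Complex.exp_pi_mul_I, ← Complex.exp_add]
    ring_nf
  · push_cast; ring_nf
  · push_cast; ring_nf

/-! ### Real nomes -/

theorem lambertTerm_nonneg (k : ℕ) {x : ℝ} (h0 : 0 < x) (h1 : x < 1) (m : ℕ) :
    0 ≤ lambertTerm k x m := by
  have : x ^ (m + 1) < 1 := pow_lt_one₀ h0.le h1 (Nat.succ_ne_zero m)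
  have : 0 < 1 - x ^ (m + 1) := by linarith
  rw [lambertTerm]
  positivity

theorem summable_lambertTerm (k : ℕ) {x : ℝ} (h0 : 0 < x) (h1 : x < 1) :
    Summable (lambertTerm k x) := by
  refine Summable.of_nonneg_of_le (lambertTerm_nonneg k h0 h1) (fun m => ?_)
    ((summable_geometric_of_lt_one h0.le h1).mul_left (x / (1 - x)))
  have hp : x ^ (m + 1) ≤ x := pow_le_of_le_one h0.le h1.le (Nat.succ_ne_zero m)
  have hx : 0 < 1 - x := by linarith
  have hone : 1 / ((m : ℝ) + 1) ^ k ≤ 1 := by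
    rw [div_le_one (by positivity)]
    exact one_le_pow₀ (by linarith [(Nat.cast_nonneg m : (0 : ℝ) ≤ m)])
  rw [lambertTerm]
  have hpos : 0 < 1 - x ^ (m + 1) := by linarith
  calc _ ≤ 1 * (x ^ (m + 1) / (1 - x)) := by gcongr
    _ = _ := by rw [pow_succ]; ring

theorem zeta_eq_tsum {k : ℕ} (hk : 1 < k) :
    riemannZeta k = ((∑' m : ℕ, 1 / ((m : ℝ) + 1) ^ k : ℝ) : ℂ) := by
  rw [zeta_nat_eq_tsum_of_gt_one hk, Complex.ofReal_tsum, tsum_eq_zero_add']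
  · simp [show k ≠ 0 by omega]
  · have := Complex.ofRealCLM.summable (summable_inv_add_one_pow hk)
    simpa using this

/-- Termwise, `(1+y)/(1-y)/2 = y/(1-y) + 1/2`; the constants sum to `ζ(k)/2`. -/
theorem eichler_I_mul {k : ℕ} (hk : 1 < k) {t x : ℝ} (ht : 0 < t)
    (hx : x = Real.exp (-2 * Real.pi * t)) :
    eichler k (Complex.I * t) = ((S k x : ℝ) : ℂ) + riemannZeta k / 2 := by
  have h0 : 0 < x := hx ▸ Real.exp_pos _
  have h1 : x < 1 := by
    rw [hx, Real.exp_lt_one_iff]; nlinarith [mul_pos Real.pi_pos ht]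
  have he : Complex.exp (2 * Real.pi * Complex.I * (Complex.I * t)) = (x : ℂ) := by
    rw [hx, Complex.ofReal_exp]
    congr 1
    push_cast
    linear_combination 2 * Real.pi * t * Complex.I_sq
  have hs := (summable_lambertTerm k h0 h1).hasSum.add
    ((summable_inv_add_one_pow hk).hasSum.div_const 2)
  rw [eichler_eq_tsum, he, zeta_eq_tsum hk, S]
  have h := (Complex.hasSum_ofReal.2 hs).tsum_eq
  push_cast at h ⊢
  rw [← h]
  refine tsum_congr fun m => ?_
  have hp : (1 : ℂ) - (x : ℂ) ^ (m + 1) ≠ 0 :=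
    one_sub_pow_ne_zero (by rwa [Complex.norm_real, Real.norm_of_nonneg h0.le]) m
  have hm : (m : ℂ) + 1 ≠ 0 := Nat.cast_add_one_ne_zero m
  rw [nomeTerm, lambertTerm]
  push_cast
  field_simp
  ring

theorem hasMerit_of_eq_exp (k : ℕ) {x a : ℝ} (ha : 0 < a)
    (hx : x = Real.exp (-Real.pi * Real.sqrt a)) : HasMerit k x a := by
  have h0 : 0 < x := hx ▸ Real.exp_pos _
  have h1 : x < 1 := by
    rw [hx, Real.exp_lt_one_iff]
    nlinarith [mul_pos Real.pi_pos (Real.sqrt_pos.2 ha)]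
  rw [HasMerit, ← hx]
  have hp := tendsto_pow_atTop_nhds_zero_of_lt_one h0.le h1
  have hA : Filter.Tendsto (fun m : ℕ => (((m : ℝ) + 1) / ((m : ℝ) + 2)) ^ k) Filter.atTop
      (nhds (1 ^ k)) := by
    refine Filter.Tendsto.pow ?_ k
    have := tendsto_add_mul_div_add_mul_atTop_nhds (𝕜 := ℝ) 1 2 1 (d := 1) one_ne_zero
    simpa [add_comm] using this
  have hB : ∀ j : ℕ, Filter.Tendsto (fun m : ℕ => 1 - x ^ (m + j)) Filter.atTop (nhds (1 - 0)) :=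
    fun j => ((Filter.tendsto_add_atTop_iff_nat j).2 hp).const_sub 1
  have h := (hA.mul_const x).mul ((hB 1).div (hB 2) (by norm_num))
  simp only [one_pow, one_mul, sub_zero, div_one, mul_one] at h
  refine h.congr fun m => ?_
  have hpos : ∀ j : ℕ, j ≠ 0 → 1 - x ^ j ≠ 0 := fun j hj =>
    (sub_pos.2 (pow_lt_one₀ h0.le h1 hj)).ne'
  have e1 := hpos (m + 1) (by omega)
  have e2 := hpos (m + 2) (by omega)
  have e3 : (m : ℝ) + 1 ≠ 0 := by positivity
  have e4 : (m : ℝ) + 2 ≠ 0 := by positivity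
  rw [lambertTerm, lambertTerm, Pi.div_apply, div_pow]
  push_cast
  rw [show (m : ℝ) + 1 + 1 = m + 2 by ring, show m + 1 + 1 = m + 2 by ring]
  field_simp
  ring

/-! ### Relations between values at quadratic irrationalities of discriminants `-15` and `-60` -/

theorem I_mul_sqrt_fifteen_sq : (Complex.I * (Real.sqrt 15 : ℝ)) ^ 2 = -15 := by
  rw [mul_pow, Complex.I_sq, ← Complex.ofReal_pow, Real.sq_sqrt (by norm_num)]
  norm_num

theorem conj_I_mul_sqrt_fifteen :
    (starRingEnd ℂ) (Complex.I * (Real.sqrt 15 : ℝ)) = -(Complex.I * (Real.sqrt 15 : ℝ)) := by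
  rw [map_mul, Complex.conj_I, Complex.conj_ofReal]; ring

theorem conj_rho : (starRingEnd ℂ) rho = 1 - rho := by
  have : rho = (1 + Complex.I * (Real.sqrt 15 : ℝ)) / 2 := rfl
  rw [this, map_div₀, map_add, map_one, conj_I_mul_sqrt_fifteen, Complex.conj_ofNat]
  ring

theorem rho_sq : rho ^ 2 = rho - 4 := by
  rw [rho]
  linear_combination I_mul_sqrt_fifteen_sq / 4

theorem rho_mul_conj : rho * (starRingEnd ℂ) rho = 4 := by
  rw [conj_rho]
  linear_combination -rho_sq

theorem rho_ne_zero : rho ≠ 0 := fun h => by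
  have := rho_mul_conj
  rw [h, zero_mul] at this
  norm_num at this

theorem rho_im_pos : 0 < rho.im := by
  simp [rho]

theorem b_eq (n : ℕ) : (b n : ℂ) = rho ^ n + (starRingEnd ℂ) (rho ^ n) := by
  rw [b, Complex.add_conj]

theorem rho_pow_mul_conj (n : ℕ) : rho ^ n * (starRingEnd ℂ) (rho ^ n) = 4 ^ n := by
  rw [map_pow, ← mul_pow, rho_mul_conj]

theorem f_eq (n : ℕ) : (f n : ℂ) = 2 * 4 ^ n + 1 := by
  rw [f, pow_succ, pow_mul]; push_cast; norm_num; ring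

theorem g_eq (n : ℕ) : (g n : ℂ) = (f n : ℂ) ^ 2 - 4 ^ n := by
  rw [g, show (4 : ℂ) = 2 ^ 2 by norm_num, ← pow_mul, mul_comm 2 n, pow_mul]; push_cast; ring

/-- Up to translation `(ρ+1)/2` is `-conj (ρ/2)`, so the two half points in the Hecke relation at
`ρ` carry conjugate values. -/
theorem eichler_half_rho {n : ℕ} (hn : 1 ≤ n) :
    eichler (2 * n + 1) (rho / 2) + (starRingEnd ℂ) (eichler (2 * n + 1) (rho / 2))
      + 1 / 4 ^ n * eichler (2 * n + 1) (Complex.I * (Real.sqrt 15 : ℝ)) =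
      (2 + 1 / 4 ^ n) * eichler (2 * n + 1) rho := by
  have h := eichler_hecke hn rho_im_pos
  rw [show (rho + 1) / 2 = -(starRingEnd ℂ) (rho / 2) + 1 by
      rw [map_div₀, conj_rho, Complex.conj_ofNat]; ring, eichler_add_one, eichler_neg_conj,
    show 2 * rho = Complex.I * (Real.sqrt 15 : ℝ) + 1 by rw [rho]; ring, eichler_add_one] at h
  exact h

theorem eichler_rho {n : ℕ} (hn : 1 ≤ n) :
    eichler (2 * n + 1) (Complex.I * (Real.sqrt 15 : ℝ) / 2) + eichler (2 * n + 1) rho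
      + 1 / 4 ^ n * eichler (2 * n + 1) (2 * (Complex.I * (Real.sqrt 15 : ℝ))) =
      (2 + 1 / 4 ^ n) * eichler (2 * n + 1) (Complex.I * (Real.sqrt 15 : ℝ)) := by
  have h := eichler_hecke hn (τ := Complex.I * (Real.sqrt 15 : ℝ)) (by simp)
  rwa [show (Complex.I * (Real.sqrt 15 : ℝ) + 1) / 2 = rho by rw [rho]; ring] at h

theorem conj_eichler_rho (n : ℕ) :
    (starRingEnd ℂ) (eichler n rho) = eichler n rho := by
  rw [← eichler_neg_conj, conj_rho, show -(1 - rho) = rho - 1 by ring, ← eichler_add_one,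
    sub_add_cancel]

theorem conj_eichler_I_mul (k : ℕ) (t : ℝ) :
    (starRingEnd ℂ) (eichler k (Complex.I * t)) = eichler k (Complex.I * t) := by
  rw [← eichler_neg_conj, map_mul, Complex.conj_I, Complex.conj_ofReal, neg_mul, neg_neg]

/-- The period contribution to the first family. -/
def firstPeriod (n : ℕ) : ℂ := period n (rho / 4) + period n ((rho - 2) / 4)

theorem I_div_two_mul_sub_conj (z : ℂ) :
    Complex.I / 2 * (z - (starRingEnd ℂ) z) = -(z.im : ℂ) := by
  rw [Complex.sub_conj]
  push_cast
  linear_combination (z.im : ℂ) * Complex.I_sq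

theorem eichler_first {n : ℕ} (hn : 1 ≤ n) :
    ((f n : ℂ) ^ 2 - b n ^ 2) * eichler (2 * n + 1) rho
      - f n * eichler (2 * n + 1) (Complex.I * (Real.sqrt 15 : ℝ))
      - (-3) ^ n * b n * eichler (2 * n + 1) (Complex.I * (Real.sqrt 15 / 3 : ℝ)) =
    -(4 ^ n) ^ 2 * (Real.pi : ℂ) ^ (2 * n + 1) * ((firstPeriod n).im : ℂ) := by
  have hC := eichler_hecke hn (τ := rho / 2) (by simpa using rho_im_pos)
  rw [show rho / 2 / 2 = rho / 4 by ring, show (rho / 2 + 1) / 2 = (rho - 2) / 4 + 1 by ring,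
    eichler_add_one, show 2 * (rho / 2) = rho by ring] at hC
  have hR1 := eichler_reciprocity hn (τ := rho / 4) (by simpa using rho_im_pos)
  rw [show -1 / (rho / 4) = rho - 1 by
      field_simp [rho_ne_zero]; linear_combination -rho_sq,
    ← eichler_add_one _ (rho - 1), sub_add_cancel] at hR1
  have h2 : (rho - 2) / 4 ≠ 0 := ne_zero_of_im_pos (by simpa using rho_im_pos)
  have hR2 := eichler_reciprocity hn (τ := (rho - 2) / 4) (by simpa using rho_im_pos)
  rw [show -1 / ((rho - 2) / 4) = Complex.I * (Real.sqrt 15 / 3 : ℝ) + 1 by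
      rw [div_eq_iff h2, rho]
      push_cast
      linear_combination -I_mul_sqrt_fifteen_sq / 24, eichler_add_one] at hR2
  have hB := eichler_half_rho hn
  have hp1 : (rho / 4) ^ (2 * n) = (rho ^ n) ^ 2 / (4 ^ n) ^ 2 := by
    rw [div_pow, mul_comm, pow_mul, pow_mul]
  -- `(ρ-2)² = -3ρ` is the source of the factor `(-3)^n`.
  have hp2 : ((rho - 2) / 4) ^ (2 * n) = (-3) ^ n * rho ^ n / (4 ^ n) ^ 2 := by
    rw [pow_mul, ← mul_pow, ← pow_mul (4 : ℂ), mul_comm n 2, pow_mul (4 : ℂ), ← div_pow]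
    congr 1
    linear_combination rho_sq / 16
  rw [hp1] at hR1
  rw [hp2] at hR2
  have hE := conj_eichler_rho (2 * n + 1)
  have hE3 := conj_eichler_I_mul (2 * n + 1) (Real.sqrt 15 / 3)
  rw [hR1, hR2] at hC
  have hC' := congrArg (starRingEnd ℂ) hC
  simp only [map_add, map_mul, map_div₀, map_pow, map_one, map_neg, Complex.conj_ofNat,
    Complex.conj_I, Complex.conj_ofReal, hE, hE3] at hC'
  have hb := b_eq n
  have hN := rho_pow_mul_conj n
  have hP := I_div_two_mul_sub_conj (firstPeriod n)
  rw [map_pow] at hb hN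
  rw [firstPeriod, map_add] at hP
  rw [firstPeriod, f_eq, hb]
  have h4 : (4 : ℂ) ^ n ≠ 0 := pow_ne_zero n (by norm_num)
  generalize (4 : ℂ) ^ n = N at *
  generalize rho ^ n = R at *
  generalize (starRingEnd ℂ) rho ^ n = R' at *
  generalize eichler (2 * n + 1) rho = E at *
  generalize eichler (2 * n + 1) (rho / 2) = X at *
  generalize (starRingEnd ℂ) X = X' at *
  generalize eichler (2 * n + 1) (Complex.I * (Real.sqrt 15 / 3 : ℝ)) = E3 at *
  generalize eichler (2 * n + 1) (Complex.I * (Real.sqrt 15 : ℝ)) = E2 at *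
  -- `hC + hC'` is twice the real part of the Hecke relation at `ρ/2`; it contains `F(ρ/2)` only
  -- through `X + X'`, which `hB` eliminates. `hN` turns `R² + R'²` into `b_n² - 2·4^n`.
  linear_combination (norm := (field_simp; ring)) -N ^ 2 * (hC + hC')
    - N ^ 2 * (2 + 1 / N) * hB - 2 * E * hN + N ^ 2 * (Real.pi : ℂ) ^ (2 * n + 1) * hP

/-- The period contribution to the second family, apart from that of the first. -/
def secondPeriod (n : ℕ) : ℂ :=
  (4 ^ n) ^ 2 * (starRingEnd ℂ) (period n (rho / 2))
    + b n * (-3) ^ n * 4 ^ n * (period n (Complex.I * (Real.sqrt 15 / 6 : ℝ))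
      + period n ((rho + 1) / 3))

theorem eichler_second {n : ℕ} (hn : 1 ≤ n) :
    (b n : ℂ) * (5 ^ n * eichler (2 * n + 1) (Complex.I * (2 * Real.sqrt 15 / 5 : ℝ))
        + (-3) ^ n * eichler (2 * n + 1) (Complex.I * (2 * Real.sqrt 15 / 3 : ℝ)))
      = (f n : ℂ) * (g n - b n ^ 2) * eichler (2 * n + 1) rho
        - g n * eichler (2 * n + 1) (Complex.I * (Real.sqrt 15 : ℝ))
        + (Real.pi : ℂ) ^ (2 * n + 1) * (f n * (4 ^ n) ^ 2 * ((firstPeriod n).im : ℂ)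
          + ((secondPeriod n).im : ℂ) / 2) := by
  have hI := I_mul_sqrt_fifteen_sq
  have hD := eichler_hecke hn (τ := Complex.I * (Real.sqrt 15 / 3 : ℝ)) (by simp)
  rw [show Complex.I * (Real.sqrt 15 / 3 : ℝ) / 2 = Complex.I * (Real.sqrt 15 / 6 : ℝ) by
      push_cast; ring,
    show (Complex.I * (Real.sqrt 15 / 3 : ℝ) + 1) / 2 = (rho + 1) / 3 by
      rw [rho]; push_cast; ring,
    show 2 * (Complex.I * (Real.sqrt 15 / 3 : ℝ)) = Complex.I * (2 * Real.sqrt 15 / 3 : ℝ) by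
      push_cast; ring] at hD
  have h3im : 0 < (Complex.I * (Real.sqrt 15 / 6 : ℝ)).im := by simp
  have h4im : 0 < ((rho + 1) / 3).im := by simpa using rho_im_pos
  have hR3 := eichler_reciprocity hn h3im
  rw [show -1 / (Complex.I * (Real.sqrt 15 / 6 : ℝ)) = Complex.I * (2 * Real.sqrt 15 / 5 : ℝ) by
      rw [div_eq_iff (ne_zero_of_im_pos h3im)]
      push_cast
      linear_combination -hI / 15] at hR3
  have hR4 := eichler_reciprocity hn h4im
  rw [show -1 / ((rho + 1) / 3) = rho / 2 - 1 by
      rw [div_eq_iff (ne_zero_of_im_pos h4im)]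
      linear_combination -rho_sq / 6, ← eichler_add_one _ (rho / 2 - 1), sub_add_cancel] at hR4
  have hR5 := eichler_reciprocity hn (τ := rho / 2) (by simpa using rho_im_pos)
  rw [show -1 / (rho / 2) = -(starRingEnd ℂ) (rho / 2) by
      rw [div_eq_iff (div_ne_zero rho_ne_zero two_ne_zero), map_div₀, conj_rho, Complex.conj_ofNat]
      linear_combination -rho_sq / 4, eichler_neg_conj] at hR5
  have hB := eichler_half_rho hn
  have hA := eichler_first hn
  -- `(i√15/6)² = -5/12` is the source of the factor `5^n`.
  have hp3 : (Complex.I * (Real.sqrt 15 / 6 : ℝ)) ^ (2 * n) = 5 ^ n / ((-3) ^ n * 4 ^ n) := by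
    rw [pow_mul, ← mul_pow, ← div_pow]
    congr 1
    push_cast
    linear_combination hI / 36
  have hp4 : ((rho + 1) / 3) ^ (2 * n) = (starRingEnd ℂ) rho ^ n / (-3) ^ n := by
    rw [pow_mul, ← div_pow, conj_rho]
    congr 1
    linear_combination rho_sq / 9
  have hp5 : (rho / 2) ^ (2 * n) = (rho ^ n) ^ 2 / 4 ^ n := by
    rw [pow_mul, show (rho / 2) ^ 2 = rho ^ 2 / 4 by ring, div_pow, ← pow_mul, ← pow_mul, mul_comm]
  rw [hp3] at hR3
  rw [hp4] at hR4
  rw [hp5] at hR5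
  rw [hR3, hR4] at hD
  have hR5' := congrArg (starRingEnd ℂ) hR5
  simp only [map_add, map_mul, map_div₀, map_pow, Complex.conj_ofNat,
    Complex.conj_I, Complex.conj_ofReal, Complex.conj_conj] at hR5'
  have hb := b_eq n
  have hN := rho_pow_mul_conj n
  rw [map_pow] at hb hN
  have hE := conj_eichler_rho (2 * n + 1)
  have hE2 := conj_eichler_I_mul (2 * n + 1) (Real.sqrt 15)
  have hE3 := conj_eichler_I_mul (2 * n + 1) (2 * Real.sqrt 15 / 3)
  have hE5 := conj_eichler_I_mul (2 * n + 1) (2 * Real.sqrt 15 / 5)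
  have h4 : (4 : ℂ) ^ n ≠ 0 := pow_ne_zero n (by norm_num)
  have h3 : (-3 : ℂ) ^ n ≠ 0 := pow_ne_zero n (by norm_num)
  have key : (b n : ℂ) * (5 ^ n * eichler (2 * n + 1) (Complex.I * (2 * Real.sqrt 15 / 5 : ℝ))
        + (-3) ^ n * eichler (2 * n + 1) (Complex.I * (2 * Real.sqrt 15 / 3 : ℝ)))
      = (f n : ℂ) * (g n - b n ^ 2) * eichler (2 * n + 1) rho
        - g n * eichler (2 * n + 1) (Complex.I * (Real.sqrt 15 : ℝ))
        + (Real.pi : ℂ) ^ (2 * n + 1) * (f n * (4 ^ n) ^ 2 * ((firstPeriod n).im : ℂ)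
          - Complex.I / 2 * secondPeriod n) := by
    rw [secondPeriod, g_eq]
    rw [hb] at hA ⊢
    rw [f_eq] at hA ⊢
    generalize (firstPeriod n).im = p at *
    generalize (4 : ℂ) ^ n = N at *
    generalize (-3 : ℂ) ^ n = T at *
    generalize (5 : ℂ) ^ n = F at *
    generalize rho ^ n = R at *
    generalize (starRingEnd ℂ) rho ^ n = R' at *
    generalize eichler (2 * n + 1) rho = E at *
    generalize eichler (2 * n + 1) (rho / 2) = X at *
    generalize (starRingEnd ℂ) X = X' at *
    generalize eichler (2 * n + 1) (Complex.I * (Real.sqrt 15 / 3 : ℝ)) = E3 at *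
    generalize eichler (2 * n + 1) (Complex.I * (2 * Real.sqrt 15 / 3 : ℝ)) = E6 at *
    generalize eichler (2 * n + 1) (Complex.I * (2 * Real.sqrt 15 / 5 : ℝ)) = E5 at *
    generalize eichler (2 * n + 1) (Complex.I * (Real.sqrt 15 : ℝ)) = E2 at *
    -- `hD` contains `R' X`. Multiplying by `b_n = R + R'` gives `N X + R'² X`, and the conjugated
    -- reciprocity `hR5'` turns `R'² X` into `N X'` plus a period. So only `X + X'` is left, which
    -- `hB` evaluates.
    linear_combination (norm := (field_simp; ring)) (R + R') * T * N * hD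
      - (2 * N + 1) * hA - N * X * hN + N ^ 2 * hR5' - N ^ 2 * hB
  -- All values of `F` in `key` are real, so averaging with the conjugate leaves only the imaginary
  -- part of `secondPeriod`.
  have key' := congrArg (starRingEnd ℂ) key
  have hQ := I_div_two_mul_sub_conj (secondPeriod n)
  simp only [map_add, map_sub, map_mul, map_div₀, map_pow, map_neg, Complex.conj_ofNat,
    Complex.conj_I, Complex.conj_ofReal, hE, hE2, hE3, hE5] at key'
  linear_combination (key + key') / 2 - (Real.pi : ℂ) ^ (2 * n + 1) / 2 * hQ

/-! ### The Lambert series at the nomes `q_s ^ d` -/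

theorem q_pow_eq (s : ℝ) (d : ℕ) :
    q s ^ d = Real.exp (-Real.pi * Real.sqrt (s * (d : ℝ) ^ 2)) := by
  rw [q, ← Real.exp_nat_mul, Real.sqrt_mul' _ (by positivity), Real.sqrt_sq (by positivity)]
  congr 1
  ring

theorem hasMerit_q_pow (k : ℕ) {s a : ℝ} {d : ℕ} (ha : 0 < a) (h : s * (d : ℝ) ^ 2 = a) :
    HasMerit k (q s ^ d) a :=
  hasMerit_of_eq_exp k ha (by rw [q_pow_eq, h])

theorem q_pow_lt_one {s : ℝ} (hs : 0 < s) {d : ℕ} (hd : d ≠ 0) : q s ^ d < 1 := by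
  rw [q_pow_eq, Real.exp_lt_one_iff]
  have : 0 < Real.sqrt (s * (d : ℝ) ^ 2) := Real.sqrt_pos.2 (by positivity)
  nlinarith [mul_pos Real.pi_pos this]

theorem summable_lambertTerm_q_pow (k : ℕ) {s : ℝ} (hs : 0 < s) {d : ℕ} (hd : d ≠ 0) :
    Summable (lambertTerm k (q s ^ d)) :=
  summable_lambertTerm k (pow_pos (Real.exp_pos _) d) (q_pow_lt_one hs hd)

theorem summable_and_merit_q_pow (k : ℕ) {s a c : ℝ} {d : ℕ} (hs : 0 < s) (hd : d ≠ 0)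
    (h : s * (d : ℝ) ^ 2 = a) (hc : c ≤ a) :
    Summable (lambertTerm k (q s ^ d)) ∧ ∃ a : ℝ, c ≤ a ∧ HasMerit k (q s ^ d) a :=
  ⟨summable_lambertTerm_q_pow k hs hd, a, hc, hasMerit_q_pow k (h ▸ by positivity) h⟩

theorem eichler_q_pow {k : ℕ} (hk : 1 < k) {s t : ℝ} {d : ℕ} (ht : 0 < t)
    (h : s * (d : ℝ) ^ 2 = (2 * t) ^ 2) :
    eichler k (Complex.I * t) = ((S k (q s ^ d) : ℝ) : ℂ) + riemannZeta k / 2 :=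
  eichler_I_mul hk ht (by rw [q_pow_eq, h, Real.sqrt_sq (by positivity)]; ring_nf)

/-! ### The arithmetic of the coefficients -/

theorem b_zero : b 0 = 2 := by simp [b]

theorem b_one : b 1 = 1 := by simp [b, rho]

theorem b_add_two (n : ℕ) : b (n + 2) = b (n + 1) - 4 * b n := by
  have h : rho ^ (n + 2) = rho ^ (n + 1) - (4 : ℝ) * rho ^ n := by
    push_cast
    linear_combination rho ^ n * rho_sq
  rw [b, b, b, h, Complex.sub_re, Complex.re_ofReal_mul]
  ring

/-- The recurrence reads `b_{n+2} ≡ b_{n+1}` mod 2. Indices start at 1 because `b_0 = 2`. Oddness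
yields both `b_n ≠ 0` and the integrality of `r_n`, which is half a sum of integers. -/
theorem b_succ_odd (n : ℕ) : (∃ z : ℤ, Odd z ∧ b (n + 1) = z) ∧ ∃ z : ℤ, Odd z ∧ b (n + 2) = z := by
  induction n with
  | zero => exact ⟨⟨1, by decide, by simp [b_one]⟩, ⟨-7, by decide, by
      rw [b_add_two, b_zero, zero_add, b_one]; norm_num⟩⟩
  | succ n ih =>
    obtain ⟨⟨u, hu, hu'⟩, ⟨v, hv, hv'⟩⟩ := ih
    refine ⟨⟨v, hv, hv'⟩, ⟨v - 4 * u, ?_, ?_⟩⟩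
    · exact hv.sub_even ⟨2 * u, by ring⟩
    · rw [b_add_two, hu', hv']; push_cast; ring

theorem b_odd {n : ℕ} (hn : 1 ≤ n) : ∃ z : ℤ, Odd z ∧ b n = z := by
  obtain ⟨m, rfl⟩ := Nat.exists_eq_add_of_le' hn
  exact (b_succ_odd m).1

theorem b_two_mul (n : ℕ) : b (2 * n) = b n ^ 2 - 2 * 4 ^ n := by
  have h : ((b (2 * n) : ℝ) : ℂ) = ((b n ^ 2 - 2 * 4 ^ n : ℝ) : ℂ) := by
    push_cast
    rw [b_eq, b_eq, ← rho_pow_mul_conj, mul_comm 2 n, pow_mul, map_pow _ (rho ^ n)]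
    ring
  exact_mod_cast h

theorem two_mul_r (n : ℕ) : 2 * r n = 4 * 16 ^ n - b (2 * n) - (-3) ^ n * b n := by
  have h : (-3 * rho) ^ n = (((-3) ^ n : ℝ) : ℂ) * rho ^ n := by push_cast; rw [mul_pow]
  rw [r, b, b, Complex.add_re, h, Complex.re_ofReal_mul, pow_succ, pow_mul]
  norm_num
  ring

theorem f_real_eq (n : ℕ) : f n = 2 * 4 ^ n + 1 := by exact_mod_cast f_eq n

theorem g_real_eq (n : ℕ) : g n = f n ^ 2 - 4 ^ n := by exact_mod_cast g_eq n

theorem rTilde_eq (n : ℕ) :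
    rTilde n = 2 * 4 ^ n * g n - b n * (5 ^ n + (-3) ^ n + b n * f n) := by
  rw [rTilde, pow_succ, pow_mul, show (2 : ℝ) ^ 2 = 4 by norm_num]; ring

theorem r_isInt {n : ℕ} (hn : 1 ≤ n) : ∃ z : ℤ, r n = z := by
  obtain ⟨u, hu, hu'⟩ := b_odd hn
  obtain ⟨v, hv, hv'⟩ := b_odd (n := 2 * n) (by omega)
  have h3 : Odd ((-3 : ℤ) ^ n * u) := ((by decide : Odd (-3 : ℤ)).pow).mul hu
  obtain ⟨w, hw⟩ := hv.add_odd h3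
  refine ⟨2 * 16 ^ n - w, ?_⟩
  have h := two_mul_r n
  rw [hu', hv'] at h
  have hw' : ((v : ℝ) + (-3) ^ n * u) = w + w := by exact_mod_cast hw
  push_cast
  linarith

theorem rTilde_isInt {n : ℕ} (hn : 1 ≤ n) : ∃ z : ℤ, rTilde n = z := by
  obtain ⟨u, -, hu⟩ := b_odd hn
  refine ⟨2 * 4 ^ n * ((2 * 4 ^ n + 1) ^ 2 - 4 ^ n) - u * (5 ^ n + (-3) ^ n + u * (2 * 4 ^ n + 1)),
    ?_⟩
  rw [rTilde_eq, g_real_eq, f_real_eq, hu]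
  push_cast
  rfl

/-- `ρ` has absolute value 2, since `ρ · conj ρ = 4`. -/
theorem abs_b_le (n : ℕ) : |b n| ≤ 2 * 2 ^ n := by
  have h1 : ‖rho‖ = 2 := by
    have h := congrArg norm rho_mul_conj
    rw [norm_mul, Complex.norm_conj, Complex.norm_ofNat] at h
    nlinarith [norm_nonneg rho]
  have h := Complex.abs_re_le_norm (rho ^ n)
  rw [norm_pow, h1] at h
  rw [b, abs_mul, abs_two]
  linarith

theorem b_sq_le (n : ℕ) : b n ^ 2 ≤ 4 * 4 ^ n := by
  have h := pow_le_pow_left₀ (abs_nonneg _) (abs_b_le n) 2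
  rw [sq_abs, mul_pow, ← pow_mul, mul_comm n, pow_mul] at h
  norm_num at h
  exact h

theorem abs_b_mul_pow_le (n : ℕ) {x : ℝ} (hx : |x| ≤ 8) : |b n * x ^ n| ≤ 2 * 16 ^ n := by
  rw [abs_mul, abs_pow]
  calc |b n| * |x| ^ n ≤ 2 * 2 ^ n * 8 ^ n := by gcongr; exact abs_b_le n
    _ = 2 * 16 ^ n := by rw [mul_assoc, ← mul_pow]; norm_num

theorem abs_b_mul_neg_three_pow_le (n : ℕ) : |b n * (-3) ^ n| ≤ 2 * 8 ^ n := by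
  rw [abs_mul, abs_pow]
  calc |b n| * |(-3 : ℝ)| ^ n ≤ 2 * 2 ^ n * 4 ^ n := by
        gcongr
        · exact abs_b_le n
        · norm_num
    _ = 2 * 8 ^ n := by rw [mul_assoc, ← mul_pow]; norm_num

theorem r_pos {n : ℕ} (hn : 1 ≤ n) : 0 < r n := by
  have h := two_mul_r n
  rw [b_two_mul] at h
  have h1 := b_sq_le n
  have h2 := abs_le.1 (abs_b_mul_neg_three_pow_le n)
  have h3 : (8 : ℝ) ^ n ≤ 16 ^ n := by gcongr; norm_num
  have h5 : (0 : ℝ) < 4 ^ n := by positivity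
  have h7 : (2 : ℝ) * 4 ^ n ≤ 8 ^ n := by
    rw [show (8 : ℝ) = 2 * 4 by norm_num, mul_pow]
    gcongr
    exact le_self_pow₀ one_le_two (by omega)
  linarith [h2.2]

theorem rTilde_pos {n : ℕ} (hn : 1 ≤ n) : 0 < rTilde n := by
  rw [rTilde_eq, g_real_eq, f_real_eq]
  have h1 := b_sq_le n
  have h2 := abs_le.1 (abs_b_mul_pow_le n (x := -3) (by norm_num))
  have h3 := abs_le.1 (abs_b_mul_pow_le n (x := 5) (by norm_num))
  have h4 : (16 : ℝ) ^ n = (4 ^ n) ^ 2 := by rw [← pow_mul, mul_comm, pow_mul]; norm_num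
  have h5 : (4 : ℝ) ≤ 4 ^ n := le_self_pow₀ (by norm_num) (by omega)
  rw [h4] at h2 h3
  generalize (4 : ℝ) ^ n = N at *
  have h6 : b n ^ 2 * (2 * N + 1) ≤ 4 * N * (2 * N + 1) := by gcongr
  nlinarith [h2.2, h3.2, mul_pos (by linarith : 0 < N) (by linarith : 0 < N),
    mul_nonneg (by positivity : 0 ≤ N ^ 2) (by linarith : 0 ≤ N - 4)]

/-! ### The field `ℚ(√-15)` and the rationality of the period contributions -/

/-- The field `ℚ(√-15)` inside `ℂ`. -/
def quadField : Subfield ℂ where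
  carrier := {z | ∃ a c : ℚ, z = a + c * (Complex.I * (Real.sqrt 15 : ℝ))}
  zero_mem' := ⟨0, 0, by simp⟩
  one_mem' := ⟨1, 0, by simp⟩
  add_mem' := by
    rintro _ _ ⟨a, c, rfl⟩ ⟨a', c', rfl⟩
    exact ⟨a + a', c + c', by push_cast; ring⟩
  neg_mem' := by
    rintro _ ⟨a, c, rfl⟩
    exact ⟨-a, -c, by push_cast; ring⟩
  mul_mem' := by
    rintro _ _ ⟨a, c, rfl⟩ ⟨a', c', rfl⟩
    refine ⟨a * a' - 15 * c * c', a * c' + a' * c, ?_⟩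
    push_cast
    linear_combination (c : ℂ) * c' * I_mul_sqrt_fifteen_sq
  inv_mem' := by
    rintro _ ⟨a, c, rfl⟩
    by_cases h0 : a ^ 2 + 15 * c ^ 2 = 0
    · have ha : a = 0 := by nlinarith [sq_nonneg a, sq_nonneg c]
      have hc : c = 0 := by nlinarith [sq_nonneg a, sq_nonneg c]
      exact ⟨0, 0, by simp [ha, hc]⟩
    · refine ⟨a / (a ^ 2 + 15 * c ^ 2), -c / (a ^ 2 + 15 * c ^ 2), ?_⟩
      have h1 : ((a : ℂ) ^ 2 + 15 * (c : ℂ) ^ 2) ≠ 0 := by exact_mod_cast h0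
      refine inv_eq_of_mul_eq_one_right ?_
      push_cast
      rw [← div_self h1]
      linear_combination
        -(c : ℂ) ^ 2 / ((a : ℂ) ^ 2 + 15 * (c : ℂ) ^ 2) * I_mul_sqrt_fifteen_sq

theorem mem_quadField {z : ℂ} :
    z ∈ quadField ↔ ∃ a c : ℚ, z = a + c * (Complex.I * (Real.sqrt 15 : ℝ)) := Iff.rfl

theorem im_of_mem_quadField {z : ℂ} (hz : z ∈ quadField) : ∃ c : ℚ, z.im = c * Real.sqrt 15 := by
  obtain ⟨a, c, rfl⟩ := mem_quadField.1 hz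
  exact ⟨c, by simp⟩

theorem conj_mem_quadField {z : ℂ} (hz : z ∈ quadField) : (starRingEnd ℂ) z ∈ quadField := by
  obtain ⟨a, c, rfl⟩ := mem_quadField.1 hz
  refine ⟨a, -c, ?_⟩
  rw [map_add, map_mul, conj_I_mul_sqrt_fifteen, map_ratCast, map_ratCast]
  push_cast
  ring

theorem rho_mem_quadField : rho ∈ quadField := ⟨1 / 2, 1 / 2, by rw [rho]; push_cast; ring⟩

theorem period_mem_quadField (n : ℕ) {τ : ℂ} (hτ : τ ∈ quadField) : period n τ ∈ quadField := by
  refine sub_mem (mul_mem (SubfieldClass.ratCast_mem _ _) (add_mem (div_mem (one_mem _) hτ)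
    (pow_mem hτ _))) (mul_mem (ofNat_mem _ 2) (sum_mem fun j _ => mul_mem (pow_mem hτ _)
    (mul_mem (SubfieldClass.ratCast_mem _ _) (SubfieldClass.ratCast_mem _ _))))

theorem firstPeriod_mem_quadField (n : ℕ) : firstPeriod n ∈ quadField :=
  add_mem (period_mem_quadField n (div_mem rho_mem_quadField (ofNat_mem _ 4)))
    (period_mem_quadField n
      (div_mem (sub_mem rho_mem_quadField (ofNat_mem _ 2)) (ofNat_mem _ 4)))

theorem secondPeriod_mem_quadField {n : ℕ} (hn : 1 ≤ n) : secondPeriod n ∈ quadField := by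
  obtain ⟨z, -, hz⟩ := b_odd hn
  rw [secondPeriod, hz, Complex.ofReal_intCast]
  refine add_mem (mul_mem (pow_mem (pow_mem (ofNat_mem _ 4) _) _) (conj_mem_quadField
    (period_mem_quadField n (div_mem rho_mem_quadField (ofNat_mem _ 2))))) (mul_mem
      (mul_mem (mul_mem (intCast_mem _ z) (pow_mem (neg_mem (ofNat_mem _ 3)) _))
        (pow_mem (ofNat_mem _ 4) _)) (add_mem (period_mem_quadField n ⟨0, 1 / 6, ?_⟩)
          (period_mem_quadField n (div_mem (add_mem rho_mem_quadField (one_mem _))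
            (ofNat_mem _ 3)))))
  push_cast
  ring

/-! ### The two families -/

theorem first_family {n : ℕ} (hn : 1 ≤ n) :
    (r n : ℂ) * riemannZeta ((2 * n + 1 : ℕ) : ℂ) =
      ((-(4 ^ n) ^ 2 * (firstPeriod n).im * Real.pi ^ (2 * n + 1)
        + (-3) ^ n * b n * S (2 * n + 1) (q (5 / 3) ^ 2)
        + (f n ^ 2 - b n ^ 2) * S (2 * n + 1) (q 15)
        - f n * (g n - b n ^ 2) / 2 ^ (2 * n) * S (2 * n + 1) (q 15 ^ 2)
        + (f n ^ 2 - b n ^ 2) / 2 ^ (2 * n) * S (2 * n + 1) (q 15 ^ 4) : ℝ) : ℂ) := by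
  have hk : 1 < 2 * n + 1 := by omega
  have hs : 0 < Real.sqrt 15 := Real.sqrt_pos.2 (by norm_num)
  have hs2 : Real.sqrt 15 ^ 2 = 15 := Real.sq_sqrt (by norm_num)
  have h53 := eichler_q_pow hk (s := 5 / 3) (d := 2) (t := Real.sqrt 15 / 3) (by positivity)
    (by push_cast; linear_combination -4 / 9 * hs2)
  have h1 := eichler_q_pow hk (s := 15) (d := 1) (t := Real.sqrt 15 / 2) (by positivity)
    (by push_cast; linear_combination -hs2)
  have h2 := eichler_q_pow hk (s := 15) (d := 2) (t := Real.sqrt 15) (by positivity)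
    (by push_cast; linear_combination -4 * hs2)
  have h4 := eichler_q_pow hk (s := 15) (d := 4) (t := 2 * Real.sqrt 15) (by positivity)
    (by push_cast; linear_combination -16 * hs2)
  have hA := eichler_first hn
  have hρ := eichler_rho hn
  rw [show Complex.I * (Real.sqrt 15 : ℝ) / 2 = Complex.I * (Real.sqrt 15 / 2 : ℝ) by
      push_cast; ring,
    show 2 * (Complex.I * (Real.sqrt 15 : ℝ)) = Complex.I * (2 * Real.sqrt 15 : ℝ) by
      push_cast; ring, h1, h2, h4] at hρ
  rw [h53, h2] at hA
  have hr : 2 * (r n : ℂ) = 4 * (4 ^ n) ^ 2 - (b n ^ 2 - 2 * 4 ^ n) - (-3) ^ n * b n := by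
    have h := two_mul_r n
    rw [b_two_mul, show (16 : ℝ) ^ n = (4 ^ n) ^ 2 by
      rw [← pow_mul, mul_comm, pow_mul]; norm_num] at h
    exact_mod_cast h
  have h22 : (2 : ℂ) ^ (2 * n) = 4 ^ n := by rw [pow_mul]; norm_num
  have hN : (4 : ℂ) ^ n ≠ 0 := pow_ne_zero n (by norm_num)
  rw [pow_one] at hρ
  generalize riemannZeta _ = Z at *
  push_cast
  rw [h22, g_eq]
  rw [f_eq] at hA ⊢
  generalize (4 : ℂ) ^ n = N at *
  generalize eichler (2 * n + 1) rho = E at *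
  -- `hρ` replaces `F(ρ)` by values on the imaginary axis; each such value carries `Z / 2`, and `hr`
  -- identifies the total coefficient of `Z`.
  linear_combination (norm := (field_simp; ring)) hA + Z / 2 * hr
    - ((2 * N + 1) ^ 2 - (b n : ℂ) ^ 2) * hρ

theorem second_family {n : ℕ} (hn : 1 ≤ n) :
    1 / 2 * (rTilde n : ℂ) * riemannZeta ((2 * n + 1 : ℕ) : ℂ) =
      ((-(f n * (4 ^ n) ^ 2 * (firstPeriod n).im + (secondPeriod n).im / 2)
          * Real.pi ^ (2 * n + 1)
        + b n * (5 ^ n * S (2 * n + 1) (q (3 / 5) ^ 4)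
          + (-3) ^ n * S (2 * n + 1) (q (5 / 3) ^ 4))
        + f n * (g n - b n ^ 2) * S (2 * n + 1) (q 15)
        + (b n * f n - g n) * (b n * f n + g n) / 2 ^ (2 * n) * S (2 * n + 1) (q 15 ^ 2)
        + f n * (g n - b n ^ 2) / 2 ^ (2 * n) * S (2 * n + 1) (q 15 ^ 4) : ℝ) : ℂ) := by
  have hk : 1 < 2 * n + 1 := by omega
  have hs : 0 < Real.sqrt 15 := Real.sqrt_pos.2 (by norm_num)
  have hs2 : Real.sqrt 15 ^ 2 = 15 := Real.sq_sqrt (by norm_num)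
  have h53 := eichler_q_pow hk (s := 5 / 3) (d := 4) (t := 2 * Real.sqrt 15 / 3) (by positivity)
    (by push_cast; linear_combination -16 / 9 * hs2)
  have h35 := eichler_q_pow hk (s := 3 / 5) (d := 4) (t := 2 * Real.sqrt 15 / 5) (by positivity)
    (by push_cast; linear_combination -16 / 25 * hs2)
  have h1 := eichler_q_pow hk (s := 15) (d := 1) (t := Real.sqrt 15 / 2) (by positivity)
    (by push_cast; linear_combination -hs2)
  have h2 := eichler_q_pow hk (s := 15) (d := 2) (t := Real.sqrt 15) (by positivity)
    (by push_cast; linear_combination -4 * hs2)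
  have h4 := eichler_q_pow hk (s := 15) (d := 4) (t := 2 * Real.sqrt 15) (by positivity)
    (by push_cast; linear_combination -16 * hs2)
  have hA := eichler_second hn
  have hρ := eichler_rho hn
  rw [show Complex.I * (Real.sqrt 15 : ℝ) / 2 = Complex.I * (Real.sqrt 15 / 2 : ℝ) by
      push_cast; ring,
    show 2 * (Complex.I * (Real.sqrt 15 : ℝ)) = Complex.I * (2 * Real.sqrt 15 : ℝ) by
      push_cast; ring, h1, h2, h4] at hρ
  rw [h53, h35, h2] at hA
  have hr : (rTilde n : ℂ) = 2 * 4 ^ n * g n - b n * (5 ^ n + (-3) ^ n + b n * f n) := by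
    exact_mod_cast rTilde_eq n
  have h22 : (2 : ℂ) ^ (2 * n) = 4 ^ n := by rw [pow_mul]; norm_num
  have hN : (4 : ℂ) ^ n ≠ 0 := pow_ne_zero n (by norm_num)
  rw [pow_one] at hρ
  generalize riemannZeta _ = Z at *
  push_cast
  rw [h22]
  rw [g_eq] at hr hA ⊢
  rw [f_eq] at hr hA ⊢
  generalize (4 : ℂ) ^ n = N at *
  generalize eichler (2 * n + 1) rho = E at *
  linear_combination (norm := (field_simp; ring)) Z / 2 * hr - hA
    - (2 * N + 1) * ((2 * N + 1) ^ 2 - N - (b n : ℂ) ^ 2) * hρ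

/-! ### Explicit values -/

theorem zetaEvenCoeff_one : zetaEvenCoeff 1 = 1 / 6 := by
  rw [zetaEvenCoeff, mul_one, bernoulli_two]
  norm_num [Nat.factorial]

theorem zetaEvenCoeff_two : zetaEvenCoeff 2 = 1 / 90 := by
  rw [zetaEvenCoeff, bernoulli_eq_bernoulli'_of_ne_one (by norm_num), bernoulli'_four]
  norm_num [Nat.factorial]

theorem zetaEvenCoeff_three : zetaEvenCoeff 3 = 1 / 945 := by
  have h : bernoulli' 6 = 1 / 42 := by
    have h5 : bernoulli' 5 = 0 := bernoulli'_eq_zero_of_odd (by decide) (by norm_num)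
    rw [bernoulli'_def]
    norm_num [Finset.sum_range_succ, h5, Nat.choose]
  rw [zetaEvenCoeff, bernoulli_eq_bernoulli'_of_ne_one (by norm_num), h]
  norm_num [Nat.factorial]

theorem period_one (τ : ℂ) : period 1 τ = (1 / τ + τ ^ 3) / 90 - τ / 18 := by
  rw [period, Finset.sum_range_one]
  simp only [zetaEvenCoeff_one, zetaEvenCoeff_two, Nat.reduceAdd, Nat.reduceSub, Nat.reduceMul]
  push_cast
  ring

theorem period_two (τ : ℂ) : period 2 τ = (1 / τ + τ ^ 5) / 945 - (τ + τ ^ 3) / 270 := by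
  rw [period, Finset.sum_range_succ, Finset.sum_range_one]
  simp only [zetaEvenCoeff_one, zetaEvenCoeff_two, zetaEvenCoeff_three, Nat.reduceAdd,
    Nat.reduceSub, Nat.reduceMul]
  push_cast
  ring

theorem im_eq_of_eq {z : ℂ} {x y : ℝ} (h : z = x + y * (Complex.I * (Real.sqrt 15 : ℝ))) :
    z.im = y * Real.sqrt 15 := by
  rw [h]; simp

theorem firstPeriod_one_im : (firstPeriod 1).im = -5 / 216 * Real.sqrt 15 := by
  -- The real part `x` plays no role beyond making the identity in `ℚ(√-15)` exact.
  refine im_eq_of_eq (x := 7 / 720) ?_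
  have hw := I_mul_sqrt_fifteen_sq
  rw [firstPeriod, period_one, period_one, rho]
  push_cast
  generalize Complex.I * (Real.sqrt 15 : ℝ) = w at *
  rw [show (1 + w) / 2 / 4 = 1 / 8 + w / 8 by ring,
    show ((1 + w) / 2 - 2) / 4 = -3 / 8 + w / 8 by ring]
  have i1 : 1 / 2 - w / 2 = 1 / (1 / 8 + w / 8) :=
    eq_one_div_of_mul_eq_one_right (by linear_combination -hw / 16)
  have i2 : -1 - w / 3 = 1 / (-3 / 8 + w / 8) :=
    eq_one_div_of_mul_eq_one_right (by linear_combination -hw / 24)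
  rw [← i1, ← i2]
  linear_combination ((3 + w) / 512 + (w - 9) / 512) / 90 * hw

theorem firstPeriod_two_im : (firstPeriod 2).im = -1327 / 725760 * Real.sqrt 15 := by
  refine im_eq_of_eq (x := -1 / 48384) ?_
  have hw := I_mul_sqrt_fifteen_sq
  rw [firstPeriod, period_two, period_two, rho]
  push_cast
  generalize Complex.I * (Real.sqrt 15 : ℝ) = w at *
  rw [show (1 + w) / 2 / 4 = 1 / 8 + w / 8 by ring,
    show ((1 + w) / 2 - 2) / 4 = -3 / 8 + w / 8 by ring]
  have i1 : 1 / 2 - w / 2 = 1 / (1 / 8 + w / 8) :=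
    eq_one_div_of_mul_eq_one_right (by linear_combination -hw / 16)
  have i2 : -1 - w / 3 = 1 / (-3 / 8 + w / 8) :=
    eq_one_div_of_mul_eq_one_right (by linear_combination -hw / 24)
  have h3 : (1 / 8 + w / 8) ^ 3 = -11 / 128 - 3 / 128 * w := by
    linear_combination (3 + w) / 512 * hw
  have h3' : (-3 / 8 + w / 8) ^ 3 = 27 / 128 + 3 / 128 * w := by
    linear_combination (w - 9) / 512 * hw
  have h5 : (1 / 8 + w / 8) ^ 5 = 61 / 2048 + 5 / 2048 * w := by
    linear_combination (1 / 8 + w / 8) ^ 2 * h3 - (11 + 6 + 3 * w) / 8192 * hw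
  have h5' : (-3 / 8 + w / 8) ^ 5 = 27 / 2048 - 45 / 2048 * w := by
    linear_combination (-3 / 8 + w / 8) ^ 2 * h3' + (27 - 18 + 3 * w) / 8192 * hw
  rw [← i1, ← i2, h3, h3', h5, h5']
  ring

theorem secondPeriod_one_im : (secondPeriod 1).im = 1649 / 2700 * Real.sqrt 15 := by
  refine im_eq_of_eq (x := 0) ?_
  have hw := I_mul_sqrt_fifteen_sq
  have hc := conj_I_mul_sqrt_fifteen
  rw [secondPeriod, b_one, period_one, period_one, period_one, rho]
  simp only [map_add, map_sub, map_div₀, map_pow, map_one, Complex.conj_ofNat, hc]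
  rw [show Complex.I * ((Real.sqrt 15 / 6 : ℝ) : ℂ) = Complex.I * (Real.sqrt 15 : ℝ) / 6 by
    push_cast; ring]
  push_cast
  generalize Complex.I * (Real.sqrt 15 : ℝ) = w at *
  rw [show (1 + -w) / 2 / 2 = 1 / 4 - w / 4 by ring,
    show ((1 + w) / 2 + 1) / 3 = 1 / 2 + w / 6 by ring]
  have i1 : 1 / 4 + w / 4 = 1 / (1 / 4 - w / 4) :=
    eq_one_div_of_mul_eq_one_right (by linear_combination -hw / 16)
  have i2 : -2 / 5 * w = 1 / (w / 6) :=
    eq_one_div_of_mul_eq_one_right (by linear_combination -hw / 15)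
  have i3 : 3 / 4 - w / 4 = 1 / (1 / 2 + w / 6) :=
    eq_one_div_of_mul_eq_one_right (by linear_combination -hw / 24)
  have h1 : (1 / 4 - w / 4) ^ 3 = -11 / 16 + 3 / 16 * w := by
    linear_combination (3 - w) / 64 * hw
  have h2 : (w / 6) ^ 3 = -5 / 72 * w := by linear_combination w / 216 * hw
  have h3 : (1 / 2 + w / 6) ^ 3 = -1 / 2 + 1 / 18 * w := by
    linear_combination (9 + w) / 216 * hw
  rw [← i1, ← i2, ← i3, h1, h2, h3]
  ring

theorem b_values : b 2 = -7 ∧ b 3 = -11 ∧ b 4 = 17 ∧ b 5 = 61 ∧ b 6 = -7 ∧ b 7 = -251 := by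
  have h2 : b 2 = -7 := by rw [b_add_two, b_zero, zero_add, b_one]; norm_num
  have h3 : b 3 = -11 := by rw [b_add_two, h2, b_one]; norm_num
  have h4 : b 4 = 17 := by rw [b_add_two, h3, h2]; norm_num
  have h5 : b 5 = 61 := by rw [b_add_two, h4, h3]; norm_num
  have h6 : b 6 = -7 := by rw [b_add_two, h5, h4]; norm_num
  have h7 : b 7 = -251 := by rw [b_add_two, h6, h5]; norm_num
  exact ⟨h2, h3, h4, h5, h6, h7⟩

theorem r_eq (n : ℕ) : r n = (4 * 16 ^ n - (b n ^ 2 - 2 * 4 ^ n) - (-3) ^ n * b n) / 2 := by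
  have h := two_mul_r n
  rw [b_two_mul] at h
  linarith

theorem r_values : r 1 = 37 ∧ r 2 = 535 ∧ r 3 = 8047 ∧ r 4 = 130495 ∧ r 5 = 2103727 ∧
    r 6 = 33561055 ∧ r 7 = 536581327 := by
  obtain ⟨h2, h3, h4, h5, h6, h7⟩ := b_values
  simp only [r_eq, b_one, h2, h3, h4, h5, h6, h7]
  norm_num

theorem rTilde_values : rTilde 1 = 605 ∧ rTilde 2 = 32957 ∧ rTilde 3 = 2107325 ∧
    rTilde 4 = 134451197 ∧ rTilde 5 = 8588427965 := by
  obtain ⟨h2, h3, h4, h5, -⟩ := b_values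
  simp only [rTilde_eq, g_real_eq, f_real_eq, b_one, h2, h3, h4, h5]
  norm_num

theorem zeta_three_first : riemannZeta 3 =
    ((10 * Real.sqrt 15 / 999 * Real.pi ^ 3
      - 3 / 37 * S 3 (q (5 / 3) ^ 2) + 80 / 37 * S 3 (q 15) - 171 / 37 * S 3 (q 15 ^ 2)
      + 20 / 37 * S 3 (q 15 ^ 4) : ℝ) : ℂ) := by
  have h := first_family (n := 1) le_rfl
  rw [r_values.1, firstPeriod_one_im, b_one, g_real_eq, f_real_eq] at h
  simp only [Nat.reduceMul, Nat.reduceAdd, Nat.cast_ofNat] at h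
  push_cast at h ⊢
  linear_combination h / 37

theorem zeta_five_first : riemannZeta 5 =
    ((1327 * Real.sqrt 15 / 1516725 * Real.pi ^ 5
      - 63 / 535 * S 5 (q (5 / 3) ^ 2) + 208 / 107 * S 5 (q 15) - 2112 / 535 * S 5 (q 15 ^ 2)
      + 13 / 107 * S 5 (q 15 ^ 4) : ℝ) : ℂ) := by
  have h := first_family (n := 2) one_le_two
  rw [r_values.2.1, firstPeriod_two_im, b_values.1, g_real_eq, f_real_eq] at h
  simp only [Nat.reduceMul, Nat.reduceAdd, Nat.cast_ofNat] at h
  push_cast at h ⊢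
  linear_combination h / 535

theorem zeta_three_second : riemannZeta 3 =
    ((16351 / (330 ^ 2 * Real.sqrt 15) * Real.pi ^ 3
      + 2 / 121 * S 3 (q (3 / 5) ^ 4) - 6 / 605 * S 3 (q (5 / 3) ^ 4)
      + 342 / 605 * (4 * S 3 (q 15) + S 3 (q 15 ^ 4))
      - 2924 / 605 * S 3 (q 15 ^ 2) : ℝ) : ℂ) := by
  have h := second_family (n := 1) le_rfl
  have hs : 16351 / (330 ^ 2 * Real.sqrt 15) = 16351 / (330 ^ 2 * 15) * Real.sqrt 15 := by
    have h0 : 0 < Real.sqrt 15 := Real.sqrt_pos.2 (by norm_num)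
    have h2 : Real.sqrt 15 ^ 2 = 15 := Real.sq_sqrt (by norm_num)
    rw [div_eq_iff (by positivity)]
    linear_combination -16351 / 15 * h2
  rw [hs]
  rw [rTilde_values.1, firstPeriod_one_im, secondPeriod_one_im, b_one, g_real_eq, f_real_eq] at h
  simp only [Nat.reduceMul, Nat.reduceAdd, Nat.cast_ofNat] at h
  push_cast at h ⊢
  linear_combination 2 / 605 * h

end LambertZeta

end

theorem mainTheorem6 :
    (∀ n k : ℕ, 1 ≤ n → k = 2 * n + 1 →
      -- integrality and non-vanishing
      (∃ z : ℤ, LambertZeta.b n = z) ∧ LambertZeta.b n ≠ 0 ∧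
      (∃ z : ℤ, LambertZeta.r n = z) ∧ 0 < LambertZeta.r n ∧
      (∃ z : ℤ, LambertZeta.rTilde n = z) ∧ 0 < LambertZeta.rTilde n ∧
      -- the first family
      (∃ e : ℚ, (LambertZeta.r n : ℂ) * riemannZeta (k : ℂ) =
        (((e : ℝ) * Real.sqrt 15 * Real.pi ^ k
          + (-3) ^ n * LambertZeta.b n * LambertZeta.S k (LambertZeta.q (5 / 3) ^ 2)
          + (LambertZeta.f n ^ 2 - LambertZeta.b n ^ 2) * LambertZeta.S k (LambertZeta.q 15)
          - LambertZeta.f n * (LambertZeta.g n - LambertZeta.b n ^ 2) / 2 ^ (2 * n)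
              * LambertZeta.S k (LambertZeta.q 15 ^ 2)
          + (LambertZeta.f n ^ 2 - LambertZeta.b n ^ 2) / 2 ^ (2 * n)
              * LambertZeta.S k (LambertZeta.q 15 ^ 4) : ℝ) : ℂ)) ∧
      -- the second family
      (∃ a : ℚ, ∃ c : ℕ → ℝ,
        c 1 = LambertZeta.f n * (LambertZeta.g n - LambertZeta.b n ^ 2) ∧
        2 ^ (2 * n) * c 4 = LambertZeta.f n * (LambertZeta.g n - LambertZeta.b n ^ 2) ∧
        2 ^ (2 * n) * c 2 = (LambertZeta.b n * LambertZeta.f n - LambertZeta.g n)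
          * (LambertZeta.b n * LambertZeta.f n + LambertZeta.g n) ∧
        1 / 2 * (LambertZeta.rTilde n : ℂ) * riemannZeta (k : ℂ) =
        (((a : ℝ) * Real.sqrt 15 * Real.pi ^ k
          + LambertZeta.b n * (5 ^ n * LambertZeta.S k (LambertZeta.q (3 / 5) ^ 4)
              + (-3) ^ n * LambertZeta.S k (LambertZeta.q (5 / 3) ^ 4))
          + ∑ d ∈ ({1, 2, 4} : Finset ℕ), c d * LambertZeta.S k (LambertZeta.q 15 ^ d) : ℝ) : ℂ)) ∧
      -- convergence and merit in the first family
      (∀ x ∈ ({LambertZeta.q (5 / 3) ^ 2, LambertZeta.q 15, LambertZeta.q 15 ^ 2,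
          LambertZeta.q 15 ^ 4} : Set ℝ),
        Summable (LambertZeta.lambertTerm k x) ∧
          ∃ a : ℝ, 20 / 3 ≤ a ∧ LambertZeta.HasMerit k x a) ∧
      LambertZeta.HasMerit k (LambertZeta.q (5 / 3) ^ 2) (20 / 3) ∧
      -- convergence and merit in the second family
      (∀ x ∈ ({LambertZeta.q (3 / 5) ^ 4, LambertZeta.q (5 / 3) ^ 4, LambertZeta.q 15,
          LambertZeta.q 15 ^ 2, LambertZeta.q 15 ^ 4} : Set ℝ),
        Summable (LambertZeta.lambertTerm k x) ∧
          ∃ a : ℝ, 48 / 5 ≤ a ∧ LambertZeta.HasMerit k x a) ∧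
      LambertZeta.HasMerit k (LambertZeta.q (3 / 5) ^ 4) (48 / 5)) ∧
    -- the first denominators
    (LambertZeta.r 1 = 37 ∧ LambertZeta.r 2 = 535 ∧ LambertZeta.r 3 = 8047 ∧
      LambertZeta.r 4 = 130495 ∧ LambertZeta.r 5 = 2103727 ∧ LambertZeta.r 6 = 33561055 ∧
      LambertZeta.r 7 = 536581327) ∧
    (LambertZeta.rTilde 1 = 605 ∧ LambertZeta.rTilde 2 = 32957 ∧ LambertZeta.rTilde 3 = 2107325 ∧
      LambertZeta.rTilde 4 = 134451197 ∧ LambertZeta.rTilde 5 = 8588427965) ∧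
    -- the first members of the first family
    riemannZeta 3 =
      ((10 * Real.sqrt 15 / 999 * Real.pi ^ 3
        - 3 / 37 * LambertZeta.S 3 (LambertZeta.q (5 / 3) ^ 2)
        + 80 / 37 * LambertZeta.S 3 (LambertZeta.q 15)
        - 171 / 37 * LambertZeta.S 3 (LambertZeta.q 15 ^ 2)
        + 20 / 37 * LambertZeta.S 3 (LambertZeta.q 15 ^ 4) : ℝ) : ℂ) ∧
    riemannZeta 5 =
      ((1327 * Real.sqrt 15 / 1516725 * Real.pi ^ 5
        - 63 / 535 * LambertZeta.S 5 (LambertZeta.q (5 / 3) ^ 2)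
        + 208 / 107 * LambertZeta.S 5 (LambertZeta.q 15)
        - 2112 / 535 * LambertZeta.S 5 (LambertZeta.q 15 ^ 2)
        + 13 / 107 * LambertZeta.S 5 (LambertZeta.q 15 ^ 4) : ℝ) : ℂ) ∧
    -- the first member of the second family
    riemannZeta 3 =
      ((16351 / (330 ^ 2 * Real.sqrt 15) * Real.pi ^ 3
        + 2 / 121 * LambertZeta.S 3 (LambertZeta.q (3 / 5) ^ 4)
        - 6 / 605 * LambertZeta.S 3 (LambertZeta.q (5 / 3) ^ 4)
        + 342 / 605 * (4 * LambertZeta.S 3 (LambertZeta.q 15)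
            + LambertZeta.S 3 (LambertZeta.q 15 ^ 4))
        - 2924 / 605 * LambertZeta.S 3 (LambertZeta.q 15 ^ 2) : ℝ) : ℂ) := by 
  refine ⟨fun n k hn hk => ?_, LambertZeta.r_values, LambertZeta.rTilde_values,
    LambertZeta.zeta_three_first, LambertZeta.zeta_five_first, LambertZeta.zeta_three_second⟩
  subst hk
  obtain ⟨z, hz, hbz⟩ := LambertZeta.b_odd hn
  have hq : ∀ s : ℝ, LambertZeta.q s = LambertZeta.q s ^ 1 := fun s => (pow_one _).symm
  refine ⟨⟨z, hbz⟩, ?_, LambertZeta.r_isInt hn, LambertZeta.r_pos hn, LambertZeta.rTilde_isInt hn,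
    LambertZeta.rTilde_pos hn, ?_, ?_, ?_, ?_, ?_, ?_⟩
  · rw [hbz]
    have h0 : z ≠ 0 := fun h => by simp [h] at hz
    exact_mod_cast h0
  · obtain ⟨c, hc⟩ :=
      LambertZeta.im_of_mem_quadField (LambertZeta.firstPeriod_mem_quadField n)
    refine ⟨-(4 ^ n) ^ 2 * c, ?_⟩
    rw [LambertZeta.first_family hn, hc]
    push_cast
    ring
  · obtain ⟨c, hc⟩ :=
      LambertZeta.im_of_mem_quadField (LambertZeta.firstPeriod_mem_quadField n)
    obtain ⟨c', hc'⟩ :=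
      LambertZeta.im_of_mem_quadField (LambertZeta.secondPeriod_mem_quadField hn)
    have h2 : (2 : ℝ) ^ (2 * n) ≠ 0 := by positivity
    -- The witness must be rational while `f n` is a real number, hence its expanded form; the last
    -- branch of `c` serves `d = 4`.
    refine ⟨-((2 * 4 ^ n + 1) * (4 ^ n) ^ 2 * c + c' / 2), fun d =>
      if d = 1 then LambertZeta.f n * (LambertZeta.g n - LambertZeta.b n ^ 2)
      else if d = 2 then (LambertZeta.b n * LambertZeta.f n - LambertZeta.g n)
          * (LambertZeta.b n * LambertZeta.f n + LambertZeta.g n) / 2 ^ (2 * n)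
      else LambertZeta.f n * (LambertZeta.g n - LambertZeta.b n ^ 2) / 2 ^ (2 * n),
      by simp, by simp [mul_div_cancel₀ _ h2], by simp [mul_div_cancel₀ _ h2], ?_⟩
    rw [LambertZeta.second_family hn, hc, hc']
    congr 1
    rw [Finset.sum_insert (by decide), Finset.sum_insert (by decide), Finset.sum_singleton]
    simp only [if_true, OfNat.ofNat_ne_one, if_false, pow_one, Nat.reduceEqDiff]
    rw [LambertZeta.f_real_eq]
    push_cast
    ring
  · rintro x (rfl | rfl | rfl | rfl)
    · exact LambertZeta.summable_and_merit_q_pow _ (a := 20 / 3) (by norm_num) two_ne_zero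
        (by norm_num) (by norm_num)
    · rw [hq]
      exact LambertZeta.summable_and_merit_q_pow _ (a := 15) (by norm_num) one_ne_zero
        (by norm_num) (by norm_num)
    · exact LambertZeta.summable_and_merit_q_pow _ (a := 60) (by norm_num) two_ne_zero
        (by norm_num) (by norm_num)
    · exact LambertZeta.summable_and_merit_q_pow _ (a := 240) (by norm_num) four_ne_zero
        (by norm_num) (by norm_num)
  · exact LambertZeta.hasMerit_q_pow _ (by norm_num) (by norm_num)
  · rintro x (rfl | rfl | rfl | rfl | rfl)
    · exact LambertZeta.summable_and_merit_q_pow _ (a := 48 / 5) (by norm_num) four_ne_zero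
        (by norm_num) (by norm_num)
    · exact LambertZeta.summable_and_merit_q_pow _ (a := 80 / 3) (by norm_num) four_ne_zero
        (by norm_num) (by norm_num)
    · rw [hq]
      exact LambertZeta.summable_and_merit_q_pow _ (a := 15) (by norm_num) one_ne_zero
        (by norm_num) (by norm_num)
    · exact LambertZeta.summable_and_merit_q_pow _ (a := 60) (by norm_num) two_ne_zero
        (by norm_num) (by norm_num)
    · exact LambertZeta.summable_and_merit_q_pow _ (a := 240) (by norm_num) four_ne_zero
        (by norm_num) (by norm_num)
  · exact LambertZeta.hasMerit_q_pow _ (by norm_num) (by norm_num)
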